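/- Let $\mathbb{R}^4_2$ be $\mathbb{R}^4$ with the metric $\langle x,y\rangle=x_1y_1+x_2y_2-x_3y_3-x_4y_4$, let $U\subset\mathbb{R}^2$ be open, and let $\Psi:U\to\mathbb{R}^4_2$ be a smooth ($C^\infty$) parametrized surface $S$ which is a minimal Lorentzian surface of general type. That is: the induced metric is Lorentzian ($EG-F^2<0$), the mean curvature vector vanishes, and at every point the first normal space (the span of the values of the second fundamental tensor) is two-dimensional and $K^2-\varkappa^2>0$, where $K$ is the Gauss curvature and $\varkappa=\langle R^\perp(x,y)e_1,e_2\rangle$ is the curvature of the normal connection. Here $(x,y)$ and $(e_1,e_2)$ are orthonormal bases of the tangent and the normal plane with $\langle x,x\rangle=\langle e_1,e_1\rangle=1$, $\langle y,y\rangle=\langle e_2,e_2\rangle=-1$; $\varkappa^2$ does not depend on their choice. We say that $S$ *has a Weierstrass representation near $p\in U$* if there are nonempty open intervals $I,J\subset\mathbb{R}$, a smooth diffeomorphism $\varphi$ from $D=\{(u,v): u+v\in I,\ u-v\in J\}$ onto an open neighbourhood of $p$ contained in $U$, smooth regular null curves $\beta:I\to\mathbb{R}^4_2$, $\theta:J\to\mathbb{R}^4_2$,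 and smooth real functions $f_1,g_1,h_1$ on $I$ and $f_2,g_2,h_2$ on $J$ such that $(u,v)\in D$ are isothermal parameters for $\Psi\circ\varphi$ (i.e. $E=-G>0$, $F=0$), and $$\Psi(\varphi(u,v))=\beta(u+v)+\theta(u-v)\qquad ((u,v)\in D),$$ $$\beta'(t)=f_1(t)\big(1+g_1(t)h_1(t),\ g_1(t)-h_1(t),\ 1-g_1(t)h_1(t),\ g_1(t)+h_1(t)\big),$$ $$\theta'(s)=f_2(s)\big(1+g_2(s)h_2(s),\ g_2(s)-h_2(s),\ 1-g_2(s)h_2(s),\ g_2(s)+h_2(s)\big),$$ and for all $t\in I$, $s\in J$ $$f_1(t)f_2(s)\big(g_1(t)-g_2(s)\big)\big(h_1(t)-h_2(s)\big)\neq0,\qquad g_1'(t)\,g_2'(s)\,h_1'(t)\,h_2'(s)>0,$$ and at the point of $S$ with parameters $(u,v)\in D$, with $f_1,g_1,h_1$ and their derivatives taken at $u+v$ and $f_2,g_2,h_2$ and their derivatives at $u-v$, $$K^2-\varkappa^2=\frac{g_1'\,g_2'\,h_1'\,h_2'}{f_1^2f_2^2(g_1-g_2)^4(h_1-h_2)^4}.$$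 Let $U_0$ be the set of points of $U$ at which no nonzero null tangent vector of $S$ lies in the hyperplane $x_1+x_3=0$. Then: 1. $S$ has a Weierstrass representation near every point of $U_0$; 2. $U_0$ is open, and dense in $U$; 3. for every $p\in U$ there is an orientation preserving linear isometry $A$ of $\mathbb{R}^4_2$ such that the surface $A\circ\Psi$ has a Weierstrass representation near $p$. -/

import Mathlib

open Set
open scoped ContDiff

noncomputable section

namespace NeutralSurface

/-- The underlying vector space of `ℝ⁴₂`. Only its smooth structure (not its norm) is used;
the geometry comes from `ip`. -/
abbrev R42 : Type := Fin 4 → ℝ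

/-- The standard flat metric of signature `(2,2)`. -/
def ip (x y : R42) : ℝ := x 0 * y 0 + x 1 * y 1 - x 2 * y 2 - x 3 * y 3

/-- `Ψ_u` -/
def du (Ψ : ℝ × ℝ → R42) (q : ℝ × ℝ) : R42 := fderiv ℝ Ψ q (1, 0)

/-- `Ψ_v` -/
def dv (Ψ : ℝ × ℝ → R42) (q : ℝ × ℝ) : R42 := fderiv ℝ Ψ q (0, 1)

/-! Coefficients of the first fundamental form. -/

def coeffE (Ψ : ℝ × ℝ → R42) (q : ℝ × ℝ) : ℝ := ip (du Ψ q) (du Ψ q)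

def coeffF (Ψ : ℝ × ℝ → R42) (q : ℝ × ℝ) : ℝ := ip (du Ψ q) (dv Ψ q)

def coeffG (Ψ : ℝ × ℝ → R42) (q : ℝ × ℝ) : ℝ := ip (dv Ψ q) (dv Ψ q)

def gramDet (Ψ : ℝ × ℝ → R42) (q : ℝ × ℝ) : ℝ :=
  coeffE Ψ q * coeffG Ψ q - coeffF Ψ q ^ 2

/-- Orthogonal projection (for `ip`) of a vector onto the tangent plane spanned by `Ψ_u, Ψ_v`;
meaningful where the tangent plane is nondegenerate, i.e. `EG - F² ≠ 0`. -/
def tang (Ψ : ℝ × ℝ → R42) (q : ℝ × ℝ) (w : R42) : R42 :=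
  ((coeffG Ψ q * ip w (du Ψ q) - coeffF Ψ q * ip w (dv Ψ q)) / gramDet Ψ q) • du Ψ q +
  ((coeffE Ψ q * ip w (dv Ψ q) - coeffF Ψ q * ip w (du Ψ q)) / gramDet Ψ q) • dv Ψ q

/-- Orthogonal projection of a vector onto the normal plane. -/
def nor (Ψ : ℝ × ℝ → R42) (q : ℝ × ℝ) (w : R42) : R42 := w - tang Ψ q w

/-- Second fundamental tensor `σ(dΨ X, dΨ Y)`: the normal part of the flat derivative in the
direction `X` of the tangent field `dΨ Y`. Here `X`, `Y` are vectors in the parameter plane. -/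
def sff (Ψ : ℝ × ℝ → R42) (q X Y : ℝ × ℝ) : R42 :=
  nor Ψ q (fderiv ℝ (fun q' => fderiv ℝ Ψ q' Y) q X)

/-- Mean curvature vector: half the trace of `σ` with respect to the first fundamental form. -/
def meanCurvature (Ψ : ℝ × ℝ → R42) (q : ℝ × ℝ) : R42 :=
  (1 / (2 * gramDet Ψ q)) •
    (coeffG Ψ q • sff Ψ q (1, 0) (1, 0) - (2 * coeffF Ψ q) • sff Ψ q (1, 0) (0, 1) +
      coeffE Ψ q • sff Ψ q (0, 1) (0, 1))

/-- First normal space: the span of all values of the second fundamental tensor. -/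
def firstNormalSpace (Ψ : ℝ × ℝ → R42) (q : ℝ × ℝ) : Submodule ℝ R42 :=
  Submodule.span ℝ {w | ∃ X Y : ℝ × ℝ, w = sff Ψ q X Y}

/-- Levi-Civita connection of the surface: `∇_X Z` is the tangential part of the flat derivative
of the tangent field `Z` along the surface. -/
def covTan (Ψ : ℝ × ℝ → R42) (X : ℝ × ℝ) (Z : ℝ × ℝ → R42) : ℝ × ℝ → R42 :=
  fun q => tang Ψ q (fderiv ℝ Z q X)

/-- Normal connection: `∇^⊥_X ξ` is the normal part of the flat derivative of the normal field
`ξ` along the surface. -/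
def covNor (Ψ : ℝ × ℝ → R42) (X : ℝ × ℝ) (ξ : ℝ × ℝ → R42) : ℝ × ℝ → R42 :=
  fun q => nor Ψ q (fderiv ℝ ξ q X)

/-- Curvature tensor `R(X,Y)Z = ∇_X ∇_Y Z - ∇_Y ∇_X Z` of the surface, for `X`, `Y`, `Z` constant
in the parameter plane (so that `[X,Y] = 0`). -/
def curvTan (Ψ : ℝ × ℝ → R42) (q X Y Z : ℝ × ℝ) : R42 :=
  covTan Ψ X (covTan Ψ Y (fun q' => fderiv ℝ Ψ q' Z)) q -
    covTan Ψ Y (covTan Ψ X (fun q' => fderiv ℝ Ψ q' Z)) q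

/-- Gauss curvature `K = ⟨R(∂u,∂v)∂v, ∂u⟩ / (EG - F²)`. -/
def gaussCurvature (Ψ : ℝ × ℝ → R42) (q : ℝ × ℝ) : ℝ :=
  ip (curvTan Ψ q (1, 0) (0, 1) (0, 1)) (du Ψ q) / gramDet Ψ q

/-- Curvature tensor `R^⊥(X,Y)n = ∇^⊥_X ∇^⊥_Y n - ∇^⊥_Y ∇^⊥_X n` of the normal connection, for
`X`, `Y` constant in the parameter plane. The normal vector `n` at `q` is extended to a normal
field by projecting it to the nearby normal planes (the curvature does not depend on the
extension). -/
def curvNor (Ψ : ℝ × ℝ → R42) (q X Y : ℝ × ℝ) (n : R42) : R42 :=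
  covNor Ψ X (covNor Ψ Y (fun q' => nor Ψ q' n)) q -
    covNor Ψ Y (covNor Ψ X (fun q' => nor Ψ q' n)) q

/-- `x = dΨ X`, `y = dΨ Y` is an orthonormal basis of the tangent plane and `e₁, e₂` one of the
normal plane, with `⟨x,x⟩ = ⟨e₁,e₁⟩ = 1` and `⟨y,y⟩ = ⟨e₂,e₂⟩ = -1`. -/
structure IsAdaptedFrame (Ψ : ℝ × ℝ → R42) (q X Y : ℝ × ℝ) (e₁ e₂ : R42) : Prop where
  xx : ip (fderiv ℝ Ψ q X) (fderiv ℝ Ψ q X) = 1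
  yy : ip (fderiv ℝ Ψ q Y) (fderiv ℝ Ψ q Y) = -1
  xy : ip (fderiv ℝ Ψ q X) (fderiv ℝ Ψ q Y) = 0
  normal₁ : ∀ Z : ℝ × ℝ, ip e₁ (fderiv ℝ Ψ q Z) = 0
  normal₂ : ∀ Z : ℝ × ℝ, ip e₂ (fderiv ℝ Ψ q Z) = 0
  ee₁ : ip e₁ e₁ = 1
  ee₂ : ip e₂ e₂ = -1
  ee₁₂ : ip e₁ e₂ = 0

/-- Normal curvature `ϰ = ⟨R^⊥(x,y)e₁, e₂⟩` with respect to an adapted frame. Another adapted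
frame changes it at most by a sign, so `ϰ²` is a function on the surface. -/
def normalCurvature (Ψ : ℝ × ℝ → R42) (q X Y : ℝ × ℝ) (e₁ e₂ : R42) : ℝ :=
  ip (curvNor Ψ q X Y e₁) e₂

/-- A (parametrized, smooth) minimal Lorentzian surface of general type in `ℝ⁴₂`, in arbitrary
parameters. The condition `EG - F² < 0` says that the induced metric is Lorentzian; it includes
that the parametrization is an immersion. -/
structure IsMinimalLorentzianGeneralType (Ψ : ℝ × ℝ → R42) (U : Set (ℝ × ℝ)) : Prop where
  isOpen : IsOpen U
  smooth : ContDiffOn ℝ ∞ Ψ U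
  lorentzian : ∀ q ∈ U, gramDet Ψ q < 0
  minimal : ∀ q ∈ U, meanCurvature Ψ q = 0
  first_normal : ∀ q ∈ U, Module.finrank ℝ (firstNormalSpace Ψ q) = 2
  curvature_pos : ∀ q ∈ U, ∃ (X Y : ℝ × ℝ) (e₁ e₂ : R42), IsAdaptedFrame Ψ q X Y e₁ e₂ ∧
    0 < gaussCurvature Ψ q ^ 2 - normalCurvature Ψ q X Y e₁ e₂ ^ 2

/-- Isothermal parameters on `D`: `E = -G > 0` and `F = 0`. -/
def IsIsothermalOn (Φ : ℝ × ℝ → R42) (D : Set (ℝ × ℝ)) : Prop :=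
  ∀ q ∈ D, 0 < coeffE Φ q ∧ coeffE Φ q = -coeffG Φ q ∧ coeffF Φ q = 0

/-- A smooth regular null curve defined on `I`. -/
def IsNullCurveOn (β : ℝ → R42) (I : Set ℝ) : Prop :=
  ContDiffOn ℝ ∞ β I ∧ ∀ t ∈ I, deriv β t ≠ 0 ∧ ip (deriv β t) (deriv β t) = 0

/-- The vector `(1 + gh, g - h, 1 - gh, g + h)`. -/
def wVec (g h : ℝ) : R42 := ![1 + g * h, g - h, 1 - g * h, g + h]

/-- Near its point with parameter `p ∈ U`, the surface `Ψ : U → ℝ⁴₂` has, after a smooth change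
`φ` of the parameters, a Weierstrass representation in isothermal parameters `(u,v)`:
`Ψ (φ (u,v)) = β (u+v) + θ (u-v)`, where `u+v` and `u-v` range over open intervals. -/
def HasWeierstrassRep (Ψ : ℝ × ℝ → R42) (U : Set (ℝ × ℝ)) (p : ℝ × ℝ) : Prop :=
  ∃ (a b c d : ℝ) (φ : OpenPartialHomeomorph (ℝ × ℝ) (ℝ × ℝ))
    (β θ : ℝ → R42) (f₁ g₁ h₁ f₂ g₂ h₂ : ℝ → ℝ),
    φ.source = {q : ℝ × ℝ | q.1 + q.2 ∈ Ioo a b ∧ q.1 - q.2 ∈ Ioo c d} ∧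
    p ∈ φ.target ∧ φ.target ⊆ U ∧
    ContDiffOn ℝ ∞ φ φ.source ∧ ContDiffOn ℝ ∞ φ.symm φ.target ∧
    IsIsothermalOn (Ψ ∘ φ) φ.source ∧
    (∀ q ∈ φ.source, Ψ (φ q) = β (q.1 + q.2) + θ (q.1 - q.2)) ∧
    IsNullCurveOn β (Ioo a b) ∧ IsNullCurveOn θ (Ioo c d) ∧
    ContDiffOn ℝ ∞ f₁ (Ioo a b) ∧ ContDiffOn ℝ ∞ g₁ (Ioo a b) ∧ ContDiffOn ℝ ∞ h₁ (Ioo a b) ∧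
    ContDiffOn ℝ ∞ f₂ (Ioo c d) ∧ ContDiffOn ℝ ∞ g₂ (Ioo c d) ∧ ContDiffOn ℝ ∞ h₂ (Ioo c d) ∧
    (∀ t ∈ Ioo a b, HasDerivAt β (f₁ t • wVec (g₁ t) (h₁ t)) t) ∧
    (∀ s ∈ Ioo c d, HasDerivAt θ (f₂ s • wVec (g₂ s) (h₂ s)) s) ∧
    (∀ t ∈ Ioo a b, ∀ s ∈ Ioo c d,
      f₁ t * f₂ s * (g₁ t - g₂ s) * (h₁ t - h₂ s) ≠ 0 ∧
      0 < deriv g₁ t * deriv g₂ s * deriv h₁ t * deriv h₂ s) ∧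
    (∀ q ∈ φ.source, ∀ (X Y : ℝ × ℝ) (e₁ e₂ : R42), IsAdaptedFrame Ψ (φ q) X Y e₁ e₂ →
      gaussCurvature Ψ (φ q) ^ 2 - normalCurvature Ψ (φ q) X Y e₁ e₂ ^ 2 =
        deriv g₁ (q.1 + q.2) * deriv g₂ (q.1 - q.2) *
          deriv h₁ (q.1 + q.2) * deriv h₂ (q.1 - q.2) /
        (f₁ (q.1 + q.2) ^ 2 * f₂ (q.1 - q.2) ^ 2 *
          (g₁ (q.1 + q.2) - g₂ (q.1 - q.2)) ^ 4 * (h₁ (q.1 + q.2) - h₂ (q.1 - q.2)) ^ 4))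

/-- The points of the surface at which no null tangent direction lies in the (degenerate)
hyperplane `x₁ + x₃ = 0`. -/
def regularPoints (Ψ : ℝ × ℝ → R42) (U : Set (ℝ × ℝ)) : Set (ℝ × ℝ) :=
  {p | p ∈ U ∧ ∀ X : ℝ × ℝ, X ≠ 0 → ip (fderiv ℝ Ψ p X) (fderiv ℝ Ψ p X) = 0 →
    fderiv ℝ Ψ p X 0 + fderiv ℝ Ψ p X 2 ≠ 0}

/-- A linear motion of `ℝ⁴₂`: an orientation preserving linear isometry. -/
def IsLinearMotion (A : R42 →ₗ[ℝ] R42) : Prop :=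
  (∀ x y, ip (A x) (A y) = ip x y) ∧ LinearMap.det A = 1

end NeutralSurface

end

noncomputable section

namespace NeutralSurface

/-! ### The bilinear form -/

/-! On a Lorentzian surface the Hodge star on 1-forms comes from an involution of each tangent plane
whose eigenlines are the two null directions. Composing `dΨ` with it gives a vector-valued 1-form.
The tangential part of its exterior derivative vanishes identically, and the normal part is a
multiple of the mean curvature vector. For a minimal surface the form is therefore closed
(`fderiv_hodge_symm`). On a ball it is `df`, and `Ψ = (Ψ + f)/2 + (Ψ - f)/2` splits `Ψ` into two
maps `B`, `T` whose differentials take only null tangent values (`exists_null_decomposition`).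

At a point of `U₀` a null tangent vector is determined by its height `x₁ + x₃`. Hence `dB` vanishes
wherever `d(height B)` does, and likewise for `T`. The heights of `B` and `T` are then local
coordinates, `B` depends only on the first and `T` only on the second, and `Ψ = β(u+v) + θ(u-v)`
with null curves of constant height speed (`exists_null_chart`). A null vector of height `±1` has
the form `f (1+gh, g-h, 1-gh, g+h)` with `f = ±1/2` (`smul_wVec_eq`), which gives the Weierstrass
data.

By the Gauss and Ricci equations, `K² - ϰ² = ⟨σ(M,M),σ(M,M)⟩⟨σ(N,N),σ(N,N)⟩ / ⟨M,N⟩⁴` for null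
tangent vectors `M`, `N` with `⟨M,N⟩ ≠ 0`. For `M = β'` and `N = θ'` the factors are `⟨β'',β''⟩ =
-g₁'h₁'` and `⟨θ'',θ''⟩ = -g₂'h₂'`. This yields the curvature formula, and `K² - ϰ² > 0` yields the
sign of the product of derivatives.

`U₀` is open because it is the nonvanishing set of a continuous function (`regDisc`). For the other
claims, some motion `shear l m` gives both null directions at a given point nonzero height
(`exists_shear_ne_zero`), which proves the third. In the Weierstrass data of the moved surface the
original height is `2f(1-lg)(1-mh)`. Since `g'` and `h'` do not vanish, its zeros in each variable
are isolated, so `U₀` is dense. -/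

lemma ip_comm (x y : R42) : ip x y = ip y x := by simp only [ip]; ring

lemma ip_add_left (x y z : R42) : ip (x + y) z = ip x z + ip y z := by
  simp only [ip, Pi.add_apply]; ring

lemma ip_add_right (x y z : R42) : ip x (y + z) = ip x y + ip x z := by
  simp only [ip, Pi.add_apply]; ring

lemma ip_sub_left (x y z : R42) : ip (x - y) z = ip x z - ip y z := by
  simp only [ip, Pi.sub_apply]; ring

lemma ip_smul_left (c : ℝ) (x y : R42) : ip (c • x) y = c * ip x y := by
  simp only [ip, Pi.smul_apply, smul_eq_mul]; ring

lemma ip_smul_right (c : ℝ) (x y : R42) : ip x (c • y) = c * ip x y := by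
  simp only [ip, Pi.smul_apply, smul_eq_mul]; ring

lemma ip_zero_left (x : R42) : ip 0 x = 0 := by simp [ip]

lemma ip_sum_left {ι : Type*} (s : Finset ι) (f : ι → R42) (y : R42) :
    ip (∑ i ∈ s, f i) y = ∑ i ∈ s, ip (f i) y := by
  classical
  induction s using Finset.induction_on with
  | empty => simp [ip_zero_left]
  | insert a s ha ih => rw [Finset.sum_insert ha, Finset.sum_insert ha, ip_add_left, ih]

/-! ### Differentiating `ip`, and symmetry of second derivatives. -/

section Calculus

variable {E : Type*} [NormedAddCommGroup E] [NormedSpace ℝ E]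

lemma hasFDerivAt_ip {f g : E → R42} {f' g' : E →L[ℝ] R42} {q : E}
    (hf : HasFDerivAt f f' q) (hg : HasFDerivAt g g' q) :
    ∃ L : E →L[ℝ] ℝ, HasFDerivAt (fun x => ip (f x) (g x)) L q ∧
      ∀ X, L X = ip (f' X) (g q) + ip (f q) (g' X) := by
  have hf' := hasFDerivAt_pi'.1 hf
  have hg' := hasFDerivAt_pi'.1 hg
  refine ⟨_, ((((hf' 0).mul (hg' 0)).add ((hf' 1).mul (hg' 1))).sub
    ((hf' 2).mul (hg' 2))).sub ((hf' 3).mul (hg' 3)), fun X => ?_⟩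
  simp [ip]
  ring

lemma fderiv_ip {f g : E → R42} {q : E}
    (hf : DifferentiableAt ℝ f q) (hg : DifferentiableAt ℝ g q) (X : E) :
    fderiv ℝ (fun x => ip (f x) (g x)) q X =
      ip (fderiv ℝ f q X) (g q) + ip (f q) (fderiv ℝ g q X) := by
  obtain ⟨L, hL, h⟩ := hasFDerivAt_ip hf.hasFDerivAt hg.hasFDerivAt
  rw [hL.fderiv, h]

lemma contDiffOn_ip {n : WithTop ℕ∞} {f g : E → R42} {s : Set E}
    (hf : ContDiffOn ℝ n f s) (hg : ContDiffOn ℝ n g s) :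
    ContDiffOn ℝ n (fun x => ip (f x) (g x)) s := by
  have hf' := contDiffOn_pi.1 hf
  have hg' := contDiffOn_pi.1 hg
  exact ((((hf' 0).mul (hg' 0)).add ((hf' 1).mul (hg' 1))).sub
    ((hf' 2).mul (hg' 2))).sub ((hf' 3).mul (hg' 3))

/-- The product rule for orthogonal fields shifts a derivative from one factor to the other. Applied
to a normal and a tangent field, this is how `σ` enters the Gauss and Ricci equations. -/
lemma fderiv_ip_eq_zero {f g : E → R42} {q : E}
    (hf : DifferentiableAt ℝ f q) (hg : DifferentiableAt ℝ g q)
    (h : ∀ᶠ x in nhds q, ip (f x) (g x) = 0) (X : E) :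
    ip (fderiv ℝ f q X) (g q) = -ip (f q) (fderiv ℝ g q X) := by
  have h1 := fderiv_ip hf hg X
  rw [Filter.EventuallyEq.fderiv_eq (f := fun _ => (0 : ℝ)) h] at h1
  simp at h1
  linarith

/-- Symmetry of the second derivative, for directional derivatives. -/
lemma fderiv_fderiv_apply_comm {F : Type*} [NormedAddCommGroup F] [NormedSpace ℝ F]
    {f : E → F} {q : E} (hf : ContDiffAt ℝ ∞ f q) (X Y : E) :
    fderiv ℝ (fun x => fderiv ℝ f x Y) q X = fderiv ℝ (fun x => fderiv ℝ f x X) q Y := by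
  have hd : DifferentiableAt ℝ (fderiv ℝ f) q :=
    (hf.fderiv_right (m := ∞) (by simp)).differentiableAt (by simp)
  rw [fderiv_clm_apply hd (differentiableAt_const _),
    fderiv_clm_apply hd (differentiableAt_const _)]
  have h2 : minSmoothness ℝ 2 ≤ ∞ := by
    rw [minSmoothness_of_isRCLikeNormedField]; exact WithTop.coe_le_coe.2 le_top
  simpa using (hf.isSymmSndFDerivAt h2) X Y

end Calculus

/-! ### Tangential and normal parts -/

section Pointwise

variable {Ψ : ℝ × ℝ → R42} {q : ℝ × ℝ}

lemma fderiv_apply_eq (Ψ : ℝ × ℝ → R42) (q X : ℝ × ℝ) :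
    fderiv ℝ Ψ q X = X.1 • du Ψ q + X.2 • dv Ψ q := by
  have : X = X.1 • ((1, 0) : ℝ × ℝ) + X.2 • ((0, 1) : ℝ × ℝ) := by ext <;> simp
  conv_lhs => rw [this]
  simp only [map_add, map_smul, du, dv]

/-- Parameter components of the tangential part of a vector. -/
def tangCoef (Ψ : ℝ × ℝ → R42) (q : ℝ × ℝ) (w : R42) : ℝ × ℝ :=
  ((coeffG Ψ q * ip w (du Ψ q) - coeffF Ψ q * ip w (dv Ψ q)) / gramDet Ψ q,
    (coeffE Ψ q * ip w (dv Ψ q) - coeffF Ψ q * ip w (du Ψ q)) / gramDet Ψ q)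

lemma tang_eq (Ψ : ℝ × ℝ → R42) (q : ℝ × ℝ) (w : R42) :
    tang Ψ q w = fderiv ℝ Ψ q (tangCoef Ψ q w) := by
  rw [fderiv_apply_eq]; rfl

lemma ip_tang (hq : gramDet Ψ q ≠ 0) (w : R42) (Z : ℝ × ℝ) :
    ip (tang Ψ q w) (fderiv ℝ Ψ q Z) = ip w (fderiv ℝ Ψ q Z) := by
  rw [fderiv_apply_eq]
  have h1 : ip (tang Ψ q w) (du Ψ q) = ip w (du Ψ q) := by
    rw [tang, ip_add_left, ip_smul_left, ip_smul_left, ip_comm (dv Ψ q) (du Ψ q)]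
    change _ * coeffE Ψ q + _ * coeffF Ψ q = _
    field_simp
    rw [gramDet]; ring
  have h2 : ip (tang Ψ q w) (dv Ψ q) = ip w (dv Ψ q) := by
    rw [tang, ip_add_left, ip_smul_left, ip_smul_left]
    change _ * coeffF Ψ q + _ * coeffG Ψ q = _
    field_simp
    rw [gramDet]; ring
  simp only [ip_add_right, ip_smul_right, h1, h2]

lemma ip_nor_tangent (hq : gramDet Ψ q ≠ 0) (w : R42) (Z : ℝ × ℝ) :
    ip (nor Ψ q w) (fderiv ℝ Ψ q Z) = 0 := by
  rw [nor, ip_sub_left, ip_tang hq, sub_self]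

lemma tang_add (w w' : R42) : tang Ψ q (w + w') = tang Ψ q w + tang Ψ q w' := by
  rw [tang_eq, tang_eq, tang_eq, ← map_add]
  congr 1
  ext <;> simp only [tangCoef, ip_add_left, Prod.fst_add, Prod.snd_add] <;> ring

lemma tang_smul (c : ℝ) (w : R42) : tang Ψ q (c • w) = c • tang Ψ q w := by
  rw [tang_eq, tang_eq, ← map_smul]
  congr 1
  ext <;> simp only [tangCoef, ip_smul_left, Prod.smul_fst, Prod.smul_snd, smul_eq_mul] <;> ring

lemma nor_add (w w' : R42) : nor Ψ q (w + w') = nor Ψ q w + nor Ψ q w' := by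
  rw [nor, tang_add, nor, nor]; abel

lemma nor_smul (c : ℝ) (w : R42) : nor Ψ q (c • w) = c • nor Ψ q w := by
  rw [nor, tang_smul, nor, smul_sub]

lemma nor_tangent (hq : gramDet Ψ q ≠ 0) (Z : ℝ × ℝ) : nor Ψ q (fderiv ℝ Ψ q Z) = 0 := by
  rw [nor, tang_eq, ← map_sub]
  have : tangCoef Ψ q (fderiv ℝ Ψ q Z) = Z := by
    have h1 : ip (fderiv ℝ Ψ q Z) (du Ψ q) = Z.1 * coeffE Ψ q + Z.2 * coeffF Ψ q := by
      rw [fderiv_apply_eq, ip_add_left, ip_smul_left, ip_smul_left, ip_comm (dv Ψ q)]; rfl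
    have h2 : ip (fderiv ℝ Ψ q Z) (dv Ψ q) = Z.1 * coeffF Ψ q + Z.2 * coeffG Ψ q := by
      rw [fderiv_apply_eq, ip_add_left, ip_smul_left, ip_smul_left]; rfl
    ext
    · simp only [tangCoef, h1, h2]
      rw [div_eq_iff hq, gramDet]; ring
    · simp only [tangCoef, h1, h2]
      rw [div_eq_iff hq, gramDet]; ring
  rw [this, sub_self, map_zero]

lemma tang_of_normal {n : R42} (hn : ∀ Z, ip n (fderiv ℝ Ψ q Z) = 0) : tang Ψ q n = 0 := by
  have h1 : ip n (du Ψ q) = 0 := hn _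
  have h2 : ip n (dv Ψ q) = 0 := hn _
  simp [tang, h1, h2]

lemma nor_of_normal {n : R42} (hn : ∀ Z, ip n (fderiv ℝ Ψ q Z) = 0) : nor Ψ q n = n := by
  rw [nor, tang_of_normal hn, sub_zero]

lemma ip_tang_of_normal {n : R42} (hn : ∀ Z, ip n (fderiv ℝ Ψ q Z) = 0) (w : R42) :
    ip (tang Ψ q w) n = 0 := by
  rw [tang_eq, ip_comm, hn]

lemma ip_nor_of_normal {n : R42} (hn : ∀ Z, ip n (fderiv ℝ Ψ q Z) = 0) (w : R42) :
    ip (nor Ψ q w) n = ip w n := by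
  rw [nor, ip_sub_left, ip_tang_of_normal hn, sub_zero]

lemma ip_nor_nor (hq : gramDet Ψ q ≠ 0) (w w' : R42) :
    ip (nor Ψ q w) (nor Ψ q w') = ip (nor Ψ q w) w' := by
  rw [ip_comm, ip_nor_of_normal (ip_nor_tangent hq w), ip_comm]

end Pointwise

/-! ### Smoothness of the fundamental form and of the projections. -/

section Smooth

variable {Ψ : ℝ × ℝ → R42} {U : Set (ℝ × ℝ)}

lemma contDiffOn_fderiv_apply {E F : Type*} [NormedAddCommGroup E] [NormedSpace ℝ E]
    [NormedAddCommGroup F] [NormedSpace ℝ F] {f : E → F} {s : Set E} {N : E → E}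
    (hs : IsOpen s) (hf : ContDiffOn ℝ ∞ f s) (hN : ContDiffOn ℝ ∞ N s) :
    ContDiffOn ℝ ∞ (fun x => fderiv ℝ f x (N x)) s :=
  (hf.fderiv_of_isOpen hs (by simp)).clm_apply hN

variable (hU : IsOpen U) (hΨ : ContDiffOn ℝ ∞ Ψ U)

include hU hΨ in
lemma contDiffOn_fderiv_const (Z : ℝ × ℝ) : ContDiffOn ℝ ∞ (fun x => fderiv ℝ Ψ x Z) U :=
  contDiffOn_fderiv_apply hU hΨ contDiffOn_const

include hU hΨ in
lemma contDiffOn_coeffE : ContDiffOn ℝ ∞ (coeffE Ψ) U :=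
  contDiffOn_ip (contDiffOn_fderiv_const hU hΨ _) (contDiffOn_fderiv_const hU hΨ _)

include hU hΨ in
lemma contDiffOn_coeffF : ContDiffOn ℝ ∞ (coeffF Ψ) U :=
  contDiffOn_ip (contDiffOn_fderiv_const hU hΨ _) (contDiffOn_fderiv_const hU hΨ _)

include hU hΨ in
lemma contDiffOn_coeffG : ContDiffOn ℝ ∞ (coeffG Ψ) U :=
  contDiffOn_ip (contDiffOn_fderiv_const hU hΨ _) (contDiffOn_fderiv_const hU hΨ _)

include hU hΨ in
lemma contDiffOn_gramDet : ContDiffOn ℝ ∞ (gramDet Ψ) U :=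
  ((contDiffOn_coeffE hU hΨ).mul (contDiffOn_coeffG hU hΨ)).sub ((contDiffOn_coeffF hU hΨ).pow 2)

variable (hg : ∀ q ∈ U, gramDet Ψ q ≠ 0)

include hU hΨ hg in
lemma contDiffOn_tangCoef {w : ℝ × ℝ → R42} (hw : ContDiffOn ℝ ∞ w U) :
    ContDiffOn ℝ ∞ (fun q => tangCoef Ψ q (w q)) U := by
  have hu := contDiffOn_ip hw (contDiffOn_fderiv_const hU hΨ (1, 0))
  have hv := contDiffOn_ip hw (contDiffOn_fderiv_const hU hΨ (0, 1))
  exact ((((contDiffOn_coeffG hU hΨ).mul hu).sub ((contDiffOn_coeffF hU hΨ).mul hv)).div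
    (contDiffOn_gramDet hU hΨ) hg).prodMk
    ((((contDiffOn_coeffE hU hΨ).mul hv).sub ((contDiffOn_coeffF hU hΨ).mul hu)).div
    (contDiffOn_gramDet hU hΨ) hg)

include hU hΨ hg in
lemma contDiffOn_tang {w : ℝ × ℝ → R42} (hw : ContDiffOn ℝ ∞ w U) :
    ContDiffOn ℝ ∞ (fun q => tang Ψ q (w q)) U := by
  simp only [tang_eq]
  exact contDiffOn_fderiv_apply hU hΨ (contDiffOn_tangCoef hU hΨ hg hw)

include hU hΨ hg in
lemma contDiffOn_nor {w : ℝ × ℝ → R42} (hw : ContDiffOn ℝ ∞ w U) :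
    ContDiffOn ℝ ∞ (fun q => nor Ψ q (w q)) U :=
  hw.sub (contDiffOn_tang hU hΨ hg hw)

end Smooth

/-! ### The second fundamental tensor -/

lemma _root_.ContDiffOn.differentiableAt_of_isOpen {E F : Type*} [NormedAddCommGroup E] [NormedSpace ℝ E]
    [NormedAddCommGroup F] [NormedSpace ℝ F] {f : E → F} {s : Set E} {x : E}
    (hf : ContDiffOn ℝ ∞ f s) (hs : IsOpen s) (hx : x ∈ s) : DifferentiableAt ℝ f x :=
  (hf.contDiffAt (hs.mem_nhds hx)).differentiableAt (by simp)

section Sff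

variable {Ψ : ℝ × ℝ → R42} {q : ℝ × ℝ}

lemma sff_eq (hΨ : ContDiffAt ℝ ∞ Ψ q) (X Y : ℝ × ℝ) :
    sff Ψ q X Y = nor Ψ q (fderiv ℝ (fderiv ℝ Ψ) q X Y) := by
  have hd : DifferentiableAt ℝ (fderiv ℝ Ψ) q :=
    (hΨ.fderiv_right (m := ∞) (by simp)).differentiableAt (by simp)
  rw [sff, fderiv_clm_apply hd (differentiableAt_const _)]
  simp

lemma sff_comm (hΨ : ContDiffAt ℝ ∞ Ψ q) (X Y : ℝ × ℝ) : sff Ψ q X Y = sff Ψ q Y X := by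
  rw [sff, fderiv_fderiv_apply_comm hΨ, sff]

lemma sff_add_right (hΨ : ContDiffAt ℝ ∞ Ψ q) (X Y Z : ℝ × ℝ) :
    sff Ψ q X (Y + Z) = sff Ψ q X Y + sff Ψ q X Z := by
  simp only [sff_eq hΨ, map_add, nor_add]

lemma sff_smul_right (hΨ : ContDiffAt ℝ ∞ Ψ q) (c : ℝ) (X Y : ℝ × ℝ) :
    sff Ψ q X (c • Y) = c • sff Ψ q X Y := by
  simp only [sff_eq hΨ, map_smul, nor_smul]

lemma sff_add_left (hΨ : ContDiffAt ℝ ∞ Ψ q) (X Y Z : ℝ × ℝ) :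
    sff Ψ q (X + Y) Z = sff Ψ q X Z + sff Ψ q Y Z := by
  rw [sff_comm hΨ, sff_add_right hΨ, sff_comm hΨ Z, sff_comm hΨ Z]

lemma sff_smul_left (hΨ : ContDiffAt ℝ ∞ Ψ q) (c : ℝ) (X Y : ℝ × ℝ) :
    sff Ψ q (c • X) Y = c • sff Ψ q X Y := by
  rw [sff_comm hΨ, sff_smul_right hΨ, sff_comm hΨ Y]

lemma ip_sff_tangent (hq : gramDet Ψ q ≠ 0) (X Y Z : ℝ × ℝ) :
    ip (sff Ψ q X Y) (fderiv ℝ Ψ q Z) = 0 := ip_nor_tangent hq _ _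

/-- The normal part of the derivative of a tangent field `dΨ N`. -/
lemma nor_fderiv_tangent_field (hΨ : ContDiffAt ℝ ∞ Ψ q) (hq : gramDet Ψ q ≠ 0)
    {N : ℝ × ℝ → ℝ × ℝ} (hN : DifferentiableAt ℝ N q) (X : ℝ × ℝ) :
    nor Ψ q (fderiv ℝ (fun x => fderiv ℝ Ψ x (N x)) q X) = sff Ψ q X (N q) := by
  have hd : DifferentiableAt ℝ (fderiv ℝ Ψ) q :=
    (hΨ.fderiv_right (m := ∞) (by simp)).differentiableAt (by simp)
  rw [sff_eq hΨ, fderiv_clm_apply hd hN]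
  simp [nor_add, nor_tangent hq]

end Sff

/-! ### The equations of Gauss and Ricci -/

section GaussRicci

variable {Ψ : ℝ × ℝ → R42} {U : Set (ℝ × ℝ)} {q : ℝ × ℝ}
  (hU : IsOpen U) (hΨ : ContDiffOn ℝ ∞ Ψ U) (hg : ∀ q ∈ U, gramDet Ψ q ≠ 0) (hq : q ∈ U)

include hU hΨ hg hq in
-- The inner tangential part is the flat derivative minus its normal part, and the derivative of
-- that normal part pairs with a tangent vector through `σ`. The flat term is a third derivative of
-- `Ψ`, symmetric in `X` and `Y`, so it drops out of the curvature.
lemma ip_covTan_covTan (X Y Z W : ℝ × ℝ) :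
    ip (covTan Ψ X (covTan Ψ Y (fun q' => fderiv ℝ Ψ q' Z)) q) (fderiv ℝ Ψ q W) =
      ip (fderiv ℝ (fun x => fderiv ℝ (fun q' => fderiv ℝ Ψ q' Z) x Y) q X) (fderiv ℝ Ψ q W) +
        ip (sff Ψ q Y Z) (sff Ψ q X W) := by
  have hZ := contDiffOn_fderiv_const hU hΨ Z
  have hS := contDiffOn_fderiv_const hU hΨ W
  have hYZ : ContDiffOn ℝ ∞ (fun x => fderiv ℝ (fun q' => fderiv ℝ Ψ q' Z) x Y) U :=
    contDiffOn_fderiv_apply hU hZ contDiffOn_const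
  have hn := contDiffOn_nor hU hΨ hg hYZ
  have dYZ := hYZ.differentiableAt_of_isOpen hU hq
  have dn := hn.differentiableAt_of_isOpen hU hq
  have dW := hS.differentiableAt_of_isOpen hU hq
  have key := fderiv_ip_eq_zero dn dW (by
    filter_upwards [hU.mem_nhds hq] with x hx using ip_nor_tangent (hg x hx) _ _) X
  rw [covTan, ip_tang (hg q hq)]
  have e : fderiv ℝ (covTan Ψ Y (fun q' => fderiv ℝ Ψ q' Z)) q =
      fderiv ℝ (fun x => fderiv ℝ (fun q' => fderiv ℝ Ψ q' Z) x Y) q -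
      fderiv ℝ (fun x => nor Ψ x (fderiv ℝ (fun q' => fderiv ℝ Ψ q' Z) x Y)) q := by
    rw [← fderiv_fun_sub dYZ dn]
    congr 1
    ext1 x
    simp [covTan, nor]
  rw [e, sub_apply, ip_sub_left, key, sff, sff, ip_nor_nor (hg q hq)]
  ring

include hU hΨ hg hq in
/-- The Gauss equation. -/
lemma ip_curvTan (X Y Z W : ℝ × ℝ) :
    ip (curvTan Ψ q X Y Z) (fderiv ℝ Ψ q W) =
      ip (sff Ψ q Y Z) (sff Ψ q X W) - ip (sff Ψ q X Z) (sff Ψ q Y W) := by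
  have hZ := (contDiffOn_fderiv_const hU hΨ Z).contDiffAt (hU.mem_nhds hq)
  rw [curvTan, ip_sub_left, ip_covTan_covTan hU hΨ hg hq, ip_covTan_covTan hU hΨ hg hq,
    fderiv_fderiv_apply_comm hZ X Y]
  ring

include hU hΨ hg hq in
-- The normal derivative is the flat one minus its tangential part `dΨ C`. The derivative of that
-- tangential field has normal part `σ(X, C)`, and `C` is found by differentiating the orthogonality
-- of the extended normal field to tangent fields.
lemma ip_covNor_covNor {n e : R42} (hn : ∀ Z, ip n (fderiv ℝ Ψ q Z) = 0)
    (he : ∀ Z, ip e (fderiv ℝ Ψ q Z) = 0) (X Y : ℝ × ℝ) :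
    ∃ C : ℝ × ℝ, (∀ Z, ip (fderiv ℝ Ψ q C) (fderiv ℝ Ψ q Z) = -ip n (sff Ψ q Y Z)) ∧
      ip (covNor Ψ X (covNor Ψ Y (fun q' => nor Ψ q' n)) q) e =
      ip (fderiv ℝ (fun x => fderiv ℝ (fun q' => nor Ψ q' n) x Y) q X) e -
        ip (sff Ψ q X C) e := by
  have hξ : ContDiffOn ℝ ∞ (fun q' => nor Ψ q' n) U := contDiffOn_nor hU hΨ hg contDiffOn_const
  have hY : ContDiffOn ℝ ∞ (fun x => fderiv ℝ (fun q' => nor Ψ q' n) x Y) U :=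
    contDiffOn_fderiv_apply hU hξ contDiffOn_const
  have hC := contDiffOn_tangCoef hU hΨ hg hY
  have hΨq := hΨ.contDiffAt (hU.mem_nhds hq)
  refine ⟨tangCoef Ψ q (fderiv ℝ (fun q' => nor Ψ q' n) q Y), fun Z => ?_, ?_⟩
  · rw [← tang_eq, ip_tang (hg q hq)]
    have hZ := contDiffOn_fderiv_const hU hΨ Z
    rw [fderiv_ip_eq_zero (hξ.differentiableAt_of_isOpen hU hq)
      (hZ.differentiableAt_of_isOpen hU hq) (by
      filter_upwards [hU.mem_nhds hq] with x hx using ip_nor_tangent (hg x hx) _ _) Y,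
      nor_of_normal hn, sff, ip_comm n (nor _ _ _), ip_nor_of_normal hn, ip_comm]
  · rw [covNor, ip_nor_of_normal he, ← nor_fderiv_tangent_field hΨq (hg q hq)
      (hC.differentiableAt_of_isOpen hU hq), ip_nor_of_normal he, ← ip_sub_left]
    congr 1
    rw [← sub_apply, ← fderiv_fun_sub (hY.differentiableAt_of_isOpen hU hq)
      ((contDiffOn_fderiv_apply hU hΨ hC).differentiableAt_of_isOpen hU hq)]
    congr 2
    ext1 x
    rw [← tang_eq, covNor, nor]

include hU hΨ hg hq in
/-- The Ricci equation; `C` and `D` are `-A_n Y` and `-A_n X` for the shape operator `A_n`. -/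
lemma ip_curvNor {n e : R42} (hn : ∀ Z, ip n (fderiv ℝ Ψ q Z) = 0)
    (he : ∀ Z, ip e (fderiv ℝ Ψ q Z) = 0) (X Y : ℝ × ℝ) :
    ∃ C D : ℝ × ℝ, (∀ Z, ip (fderiv ℝ Ψ q C) (fderiv ℝ Ψ q Z) = -ip n (sff Ψ q Y Z)) ∧
      (∀ Z, ip (fderiv ℝ Ψ q D) (fderiv ℝ Ψ q Z) = -ip n (sff Ψ q X Z)) ∧
      ip (curvNor Ψ q X Y n) e = ip (sff Ψ q Y D) e - ip (sff Ψ q X C) e := by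
  obtain ⟨C, hC, h1⟩ := ip_covNor_covNor hU hΨ hg hq hn he X Y
  obtain ⟨D, hD, h2⟩ := ip_covNor_covNor hU hΨ hg hq hn he Y X
  refine ⟨C, D, hC, hD, ?_⟩
  have hξ : ContDiffOn ℝ ∞ (fun q' => nor Ψ q' n) U := contDiffOn_nor hU hΨ hg contDiffOn_const
  rw [curvNor, ip_sub_left, h1, h2,
    fderiv_fderiv_apply_comm (hξ.contDiffAt (hU.mem_nhds hq)) X Y]
  ring

end GaussRicci

/-- Four pairwise orthogonal non-null vectors form a basis of `ℝ⁴₂`: a vector orthogonal to all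
of them vanishes. -/
lemma eq_zero_of_orthogonal {v : Fin 4 → R42} (hd : ∀ i, ip (v i) (v i) ≠ 0)
    (ho : ∀ i j, i ≠ j → ip (v i) (v j) = 0) {w : R42} (hw : ∀ i, ip w (v i) = 0) : w = 0 := by
  have hli : LinearIndependent ℝ v := by
    rw [Fintype.linearIndependent_iff]
    intro c hc i
    have h := congrArg (fun x => ip x (v i)) hc
    simp only [ip_sum_left, ip_smul_left, ip_zero_left] at h
    rw [Finset.sum_eq_single i (fun j _ hj => by rw [ho j i hj, mul_zero]) (by simp)] at h
    exact (mul_eq_zero.1 h).resolve_right (hd i)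
  have hmem : w ∈ Submodule.span ℝ (Set.range v) := by
    rw [hli.span_eq_top_of_card_eq_finrank' (by simp)]; trivial
  obtain ⟨c, rfl⟩ := (Submodule.mem_span_range_iff_exists_fun ℝ).1 hmem
  have hc : ∀ i, c i = 0 := by
    intro i
    have h := hw i
    simp only [ip_sum_left, ip_smul_left] at h
    rw [Finset.sum_eq_single i (fun j _ hj => by rw [ho j i hj, mul_zero]) (by simp)] at h
    exact (mul_eq_zero.1 h).resolve_right (hd i)
  simp [hc]

/-! ### Adapted frames, and the curvatures of a minimal surface in terms of `σ`. -/

section Frame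

variable {Ψ : ℝ × ℝ → R42} {q X Y : ℝ × ℝ} {e₁ e₂ : R42}

namespace IsAdaptedFrame

variable (h : IsAdaptedFrame Ψ q X Y e₁ e₂)

include h

lemma exists_coord (Z : ℝ × ℝ) : ∃ a b : ℝ, Z = a • X + b • Y := by
  have hdet : X.1 * Y.2 - X.2 * Y.1 ≠ 0 := by
    intro h0
    have hx := h.xx
    have hy := h.yy
    have hxy := h.xy
    simp only [fderiv_apply_eq Ψ q X, fderiv_apply_eq Ψ q Y, ip_add_left, ip_add_right,
      ip_smul_left, ip_smul_right, ip_comm (dv Ψ q) (du Ψ q)] at hx hy hxy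
    have : (1 : ℝ) * (-1) - 0 * 0 = (X.1 * Y.2 - X.2 * Y.1) ^ 2 *
        (ip (du Ψ q) (du Ψ q) * ip (dv Ψ q) (dv Ψ q) - ip (du Ψ q) (dv Ψ q) ^ 2) := by
      rw [← hy, ← hx, ← hxy]; ring
    rw [h0] at this
    norm_num at this
  refine ⟨(Z.1 * Y.2 - Z.2 * Y.1) / (X.1 * Y.2 - X.2 * Y.1),
    (X.1 * Z.2 - X.2 * Z.1) / (X.1 * Y.2 - X.2 * Y.1), ?_⟩
  ext
  · simp only [Prod.fst_add, Prod.smul_fst, smul_eq_mul]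
    rw [div_mul_eq_mul_div, div_mul_eq_mul_div, ← add_div, eq_div_iff hdet]; ring
  · simp only [Prod.snd_add, Prod.smul_snd, smul_eq_mul]
    rw [div_mul_eq_mul_div, div_mul_eq_mul_div, ← add_div, eq_div_iff hdet]; ring

lemma ip_comb (a b c d : ℝ) : ip (fderiv ℝ Ψ q (a • X + b • Y)) (fderiv ℝ Ψ q (c • X + d • Y)) =
    a * c - b * d := by
  simp only [map_add, map_smul, ip_add_left, ip_add_right, ip_smul_left, ip_smul_right, h.xx, h.yy,
    h.xy, ip_comm (fderiv ℝ Ψ q Y) (fderiv ℝ Ψ q X)]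
  ring

/-- `a` minus its expansion in `e₁`, `e₂` is orthogonal to the whole adapted frame of `ℝ⁴₂`, hence
zero; the minus sign in the formula is that of `⟨e₂,e₂⟩`. -/
lemma ip_normal {a : R42} (ha : ∀ Z, ip a (fderiv ℝ Ψ q Z) = 0) (b : R42) :
    ip a b = ip a e₁ * ip b e₁ - ip a e₂ * ip b e₂ := by
  have hyx : ip (fderiv ℝ Ψ q Y) (fderiv ℝ Ψ q X) = 0 := by rw [ip_comm, h.xy]
  have h21 : ip e₂ e₁ = 0 := by rw [ip_comm, h.ee₁₂]
  have hn₁ := fun Z => (ip_comm (fderiv ℝ Ψ q Z) e₁).trans (h.normal₁ Z)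
  have hn₂ := fun Z => (ip_comm (fderiv ℝ Ψ q Z) e₂).trans (h.normal₂ Z)
  have key : a - ip a e₁ • e₁ + ip a e₂ • e₂ = 0 := by
    apply eq_zero_of_orthogonal (v := ![fderiv ℝ Ψ q X, fderiv ℝ Ψ q Y, e₁, e₂])
    · intro i
      fin_cases i <;> simp [h.xx, h.yy, h.ee₁, h.ee₂]
    · intro i j
      fin_cases i <;> fin_cases j <;>
        simp [h.xy, hyx, h.ee₁₂, h21, h.normal₁, h.normal₂, hn₁, hn₂]
    · intro i
      fin_cases i <;>
        simp [ip_add_left, ip_sub_left, ip_smul_left, ha, h.normal₁, h.normal₂, h.ee₁, h.ee₂,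
          h.ee₁₂, h21]
  have := congrArg (fun x => ip x b) key
  simp only [ip_add_left, ip_sub_left, ip_smul_left, ip_zero_left, ip_comm e₁ b,
    ip_comm e₂ b] at this
  linarith

/-- The trace of `σ` in an adapted frame is `σ(X,X) - σ(Y,Y)`. Passing to coordinates multiplies it
only by minus the squared determinant of the change of basis. -/
lemma sff_diag_eq (hΨ : ContDiffAt ℝ ∞ Ψ q) (hq : gramDet Ψ q ≠ 0)
    (hH : meanCurvature Ψ q = 0) : sff Ψ q Y Y = sff Ψ q X X := by
  obtain ⟨a, b, hu⟩ := h.exists_coord (1, 0)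
  obtain ⟨c, d, hv⟩ := h.exists_coord (0, 1)
  have hE : coeffE Ψ q = a * a - b * b := by
    rw [coeffE, du, hu]; exact h.ip_comb ..
  have hF : coeffF Ψ q = a * c - b * d := by
    rw [coeffF, du, dv, hu, hv]; exact h.ip_comb ..
  have hG : coeffG Ψ q = c * c - d * d := by
    rw [coeffG, dv, hv]; exact h.ip_comb ..
  have hdet : gramDet Ψ q = -(a * d - b * c) ^ 2 := by
    rw [gramDet, hE, hF, hG]; ring
  have hne : (a * d - b * c) ^ 2 ≠ 0 := by
    intro h0; apply hq; rw [hdet, h0, neg_zero]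
  rw [meanCurvature, smul_eq_zero] at hH
  have hH := hH.resolve_left (by simpa using hq)
  simp only [hu, hv, sff_add_left hΨ, sff_add_right hΨ, sff_smul_left hΨ, sff_smul_right hΨ, hE,
    hF, hG, sff_comm hΨ Y X] at hH
  have : (a * d - b * c) ^ 2 • (sff Ψ q Y Y - sff Ψ q X X) = 0 := by
    rw [← hH]; module
  exact sub_eq_zero.1 ((smul_eq_zero.1 this).resolve_left hne)

end IsAdaptedFrame

variable {U : Set (ℝ × ℝ)}
  (hU : IsOpen U) (hΨ : ContDiffOn ℝ ∞ Ψ U) (hg : ∀ q ∈ U, gramDet Ψ q ≠ 0) (hq : q ∈ U)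
  (hH : meanCurvature Ψ q = 0)
  (h : IsAdaptedFrame Ψ q X Y e₁ e₂)

include hU hΨ hg hq hH h

lemma gaussCurvature_eq : gaussCurvature Ψ q =
    ip (sff Ψ q X Y) (sff Ψ q X Y) - ip (sff Ψ q X X) (sff Ψ q X X) := by
  have hΨq := hΨ.contDiffAt (hU.mem_nhds hq)
  have hdiag := h.sff_diag_eq hΨq (hg q hq) hH
  obtain ⟨a, b, hu⟩ := h.exists_coord (1, 0)
  obtain ⟨c, d, hv⟩ := h.exists_coord (0, 1)
  have hdet : gramDet Ψ q = -(a * d - b * c) ^ 2 := by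
    rw [gramDet, coeffE, coeffF, coeffG, du, dv, hu, hv, h.ip_comb, h.ip_comb, h.ip_comb]; ring
  rw [gaussCurvature, div_eq_iff (hg q hq), du, ip_curvTan hU hΨ hg hq, hdet]
  simp only [hu, hv, sff_add_left hΨq, sff_add_right hΨq, sff_smul_left hΨq, sff_smul_right hΨq,
    sff_comm hΨq Y X, hdiag, ip_add_left, ip_add_right, ip_smul_left, ip_smul_right,
    ip_comm (sff Ψ q X Y) (sff Ψ q X X)]
  ring

lemma normalCurvature_eq : normalCurvature Ψ q X Y e₁ e₂ =
    2 * (ip (sff Ψ q X Y) e₁ * ip (sff Ψ q X X) e₂ -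
      ip (sff Ψ q X X) e₁ * ip (sff Ψ q X Y) e₂) := by
  have hΨq := hΨ.contDiffAt (hU.mem_nhds hq)
  have hdiag := h.sff_diag_eq hΨq (hg q hq) hH
  obtain ⟨C, D, hC, hD, hr⟩ := ip_curvNor hU hΨ hg hq h.normal₁ h.normal₂ X Y
  obtain ⟨a, b, rfl⟩ := h.exists_coord C
  obtain ⟨c, d, rfl⟩ := h.exists_coord D
  have hXX : ∀ a b : ℝ, ip (fderiv ℝ Ψ q (a • X + b • Y)) (fderiv ℝ Ψ q X) = a := by
    intro a b; simpa using h.ip_comb a b 1 0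
  have hYY : ∀ a b : ℝ, ip (fderiv ℝ Ψ q (a • X + b • Y)) (fderiv ℝ Ψ q Y) = -b := by
    intro a b; simpa using h.ip_comb a b 0 1
  have ha := hC X
  have hb := hC Y
  have hc := hD X
  have hd := hD Y
  rw [hXX, sff_comm hΨq Y X] at ha
  rw [hXX] at hc
  rw [hYY, hdiag] at hb
  rw [hYY] at hd
  rw [normalCurvature, hr]
  simp only [sff_add_right hΨq, sff_smul_right hΨq, sff_comm hΨq Y X, hdiag, ip_add_left,
    ip_smul_left, ha, hc, neg_inj.1 hb, neg_inj.1 hd, ip_comm e₁]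
  ring

/-- The invariant `K² - ϰ²` of a minimal surface in terms of null tangent vectors. -/
lemma gaussCurvature_sq_sub_normalCurvature_sq {M N : ℝ × ℝ}
    (hM : ip (fderiv ℝ Ψ q M) (fderiv ℝ Ψ q M) = 0) (hN : ip (fderiv ℝ Ψ q N) (fderiv ℝ Ψ q N) = 0)
    (hMN : ip (fderiv ℝ Ψ q M) (fderiv ℝ Ψ q N) ≠ 0) :
    gaussCurvature Ψ q ^ 2 - normalCurvature Ψ q X Y e₁ e₂ ^ 2 =
      ip (sff Ψ q M M) (sff Ψ q M M) * ip (sff Ψ q N N) (sff Ψ q N N) /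
        ip (fderiv ℝ Ψ q M) (fderiv ℝ Ψ q N) ^ 4 := by
  have hΨq := hΨ.contDiffAt (hU.mem_nhds hq)
  have hdiag := h.sff_diag_eq hΨq (hg q hq) hH
  have hn : ∀ X Y Z, ip (sff Ψ q X Y) (fderiv ℝ Ψ q Z) = 0 := ip_sff_tangent (hg q hq)
  obtain ⟨a, b, rfl⟩ := h.exists_coord M
  obtain ⟨c, d, rfl⟩ := h.exists_coord N
  rw [h.ip_comb] at hM hN hMN
  rw [h.ip_comb, eq_div_iff (pow_ne_zero _ hMN), gaussCurvature_eq hU hΨ hg hq hH h,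
    normalCurvature_eq hU hΨ hg hq hH h]
  have e11 := h.ip_normal (hn X X) (sff Ψ q X X)
  have e12 := h.ip_normal (hn X X) (sff Ψ q X Y)
  have e22 := h.ip_normal (hn X Y) (sff Ψ q X Y)
  -- Null tangent vectors are multiples of `X + Y` or of `X - Y`, and `⟨M,N⟩ ≠ 0` forces one of
  -- each. What remains is the Lagrange identity in the normal plane for `σ(X,X)` and `σ(X,Y)`.
  have hb : b = a ∨ b = -a := sq_eq_sq_iff_eq_or_eq_neg.1 (by linarith)
  have hd : d = c ∨ d = -c := sq_eq_sq_iff_eq_or_eq_neg.1 (by linarith)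
  simp only [sff_add_left hΨq, sff_add_right hΨq, sff_smul_left hΨq, sff_smul_right hΨq,
    sff_comm hΨq Y X, hdiag, ip_add_left, ip_add_right, ip_smul_left, ip_smul_right,
    ip_comm (sff Ψ q X Y) (sff Ψ q X X)]
  rw [e11, e12, e22]
  rcases hb with rfl | rfl <;> rcases hd with rfl | rfl
  · exact absurd (by ring) hMN
  · ring
  · ring
  · exact absurd (by ring) hMN

end Frame

/-! ### Behaviour under linear isometries -/

section Isometry

variable (L : R42 ≃L[ℝ] R42) (hL : ∀ x y, ip (L x) (L y) = ip x y) (Ψ : ℝ × ℝ → R42)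

lemma fderiv_isometry (q X : ℝ × ℝ) :
    fderiv ℝ (fun q => L (Ψ q)) q X = L (fderiv ℝ Ψ q X) :=
  congrArg (fun T => T X) (L.comp_fderiv (f := Ψ) (x := q))

include hL

lemma coeffE_isometry (q : ℝ × ℝ) : coeffE (fun q => L (Ψ q)) q = coeffE Ψ q := by
  simp only [coeffE, du, fderiv_isometry, hL]

lemma coeffF_isometry (q : ℝ × ℝ) : coeffF (fun q => L (Ψ q)) q = coeffF Ψ q := by
  simp only [coeffF, du, dv, fderiv_isometry, hL]

lemma coeffG_isometry (q : ℝ × ℝ) : coeffG (fun q => L (Ψ q)) q = coeffG Ψ q := by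
  simp only [coeffG, dv, fderiv_isometry, hL]

lemma gramDet_isometry (q : ℝ × ℝ) : gramDet (fun q => L (Ψ q)) q = gramDet Ψ q := by
  simp only [gramDet, coeffE_isometry L hL, coeffF_isometry L hL, coeffG_isometry L hL]

lemma tang_isometry (q : ℝ × ℝ) (w : R42) :
    tang (fun q => L (Ψ q)) q (L w) = L (tang Ψ q w) := by
  simp only [tang, du, dv, fderiv_isometry, hL, map_add, map_smul, coeffE_isometry L hL,
    coeffF_isometry L hL, coeffG_isometry L hL, gramDet_isometry L hL]

lemma nor_isometry (q : ℝ × ℝ) (w : R42) :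
    nor (fun q => L (Ψ q)) q (L w) = L (nor Ψ q w) := by
  rw [nor, tang_isometry L hL, nor, map_sub]

lemma sff_isometry (q X Y : ℝ × ℝ) : sff (fun q => L (Ψ q)) q X Y = L (sff Ψ q X Y) := by
  simp only [sff, fderiv_isometry, nor_isometry L hL]

lemma meanCurvature_isometry (q : ℝ × ℝ) :
    meanCurvature (fun q => L (Ψ q)) q = L (meanCurvature Ψ q) := by
  simp only [meanCurvature, sff_isometry L hL, coeffE_isometry L hL, coeffF_isometry L hL,
    coeffG_isometry L hL, gramDet_isometry L hL, map_add, map_sub, map_smul]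

lemma covTan_isometry (X : ℝ × ℝ) (Z : ℝ × ℝ → R42) :
    covTan (fun q => L (Ψ q)) X (fun q => L (Z q)) = fun q => L (covTan Ψ X Z q) := by
  funext q
  rw [covTan, fderiv_isometry, tang_isometry L hL, covTan]

lemma covNor_isometry (X : ℝ × ℝ) (ξ : ℝ × ℝ → R42) :
    covNor (fun q => L (Ψ q)) X (fun q => L (ξ q)) = fun q => L (covNor Ψ X ξ q) := by
  funext q
  rw [covNor, fderiv_isometry, nor_isometry L hL, covNor]

lemma gaussCurvature_isometry (q : ℝ × ℝ) :
    gaussCurvature (fun q => L (Ψ q)) q = gaussCurvature Ψ q := by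
  simp only [gaussCurvature, curvTan, du, fderiv_isometry, covTan_isometry L hL,
    gramDet_isometry L hL, ← map_sub, hL]

lemma normalCurvature_isometry (q X Y : ℝ × ℝ) (e₁ e₂ : R42) :
    normalCurvature (fun q => L (Ψ q)) q X Y (L e₁) (L e₂) = normalCurvature Ψ q X Y e₁ e₂ := by
  simp only [normalCurvature, curvNor, nor_isometry L hL, covNor_isometry L hL, ← map_sub, hL]

variable {Ψ}

lemma IsAdaptedFrame.isometry {q X Y : ℝ × ℝ} {e₁ e₂ : R42} (h : IsAdaptedFrame Ψ q X Y e₁ e₂) :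
    IsAdaptedFrame (fun q => L (Ψ q)) q X Y (L e₁) (L e₂) where
  xx := by rw [fderiv_isometry, hL, h.xx]
  yy := by rw [fderiv_isometry, hL, h.yy]
  xy := by rw [fderiv_isometry, fderiv_isometry, hL, h.xy]
  normal₁ Z := by rw [fderiv_isometry, hL, h.normal₁]
  normal₂ Z := by rw [fderiv_isometry, hL, h.normal₂]
  ee₁ := by rw [hL, h.ee₁]
  ee₂ := by rw [hL, h.ee₂]
  ee₁₂ := by rw [hL, h.ee₁₂]

lemma firstNormalSpace_isometry (q : ℝ × ℝ) :
    firstNormalSpace (fun q => L (Ψ q)) q =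
      (firstNormalSpace Ψ q).map (L.toLinearEquiv : R42 →ₗ[ℝ] R42) := by
  rw [firstNormalSpace, firstNormalSpace, Submodule.map_span]
  congr 1
  ext w
  constructor
  · rintro ⟨X, Y, rfl⟩
    exact ⟨_, ⟨X, Y, rfl⟩, (sff_isometry L hL Ψ q X Y).symm⟩
  · rintro ⟨_, ⟨X, Y, rfl⟩, rfl⟩
    exact ⟨X, Y, (sff_isometry L hL Ψ q X Y).symm⟩

/-- All the data are built from `ip` and flat derivatives, and both are compatible with `L`. This
lets the representation at regular points be applied to a moved surface. -/
lemma IsMinimalLorentzianGeneralType.isometry {U : Set (ℝ × ℝ)}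
    (hS : IsMinimalLorentzianGeneralType Ψ U) :
    IsMinimalLorentzianGeneralType (fun q => L (Ψ q)) U where
  isOpen := hS.isOpen
  smooth := L.contDiff.comp_contDiffOn hS.smooth
  lorentzian q hq := by rw [gramDet_isometry L hL]; exact hS.lorentzian q hq
  minimal q hq := by rw [meanCurvature_isometry L hL, hS.minimal q hq, map_zero]
  first_normal q hq := by
    rw [firstNormalSpace_isometry L hL, LinearEquiv.finrank_map_eq]
    exact hS.first_normal q hq
  curvature_pos q hq := by
    obtain ⟨X, Y, e₁, e₂, h, hpos⟩ := hS.curvature_pos q hq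
    refine ⟨X, Y, L e₁, L e₂, h.isometry L hL, ?_⟩
    rwa [gaussCurvature_isometry L hL, normalCurvature_isometry L hL]

end Isometry

/-! ### A family of motions

Identify `x` with the matrix `M = !![x₁ + x₃, x₄ - x₂; x₂ + x₄, x₁ - x₃]`, whose determinant is
`ip x x`. The motion `shear l m` is `M ↦ !![1, l; 0, 1] * M * !![1, 0; m, 1]`. -/

/-- The matrix of `shear`. -/
def shearMatrix (l m : ℝ) : Matrix (Fin 4) (Fin 4) ℝ :=
  !![1 + l * m / 2, (l - m) / 2, -(l * m / 2), (l + m) / 2;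
    (m - l) / 2, 1, -((m - l) / 2), 0;
    l * m / 2, (l - m) / 2, 1 - l * m / 2, (l + m) / 2;
    (l + m) / 2, 0, -((l + m) / 2), 1]

/-- A two-parameter family of linear motions. -/
def shear (l m : ℝ) : R42 →ₗ[ℝ] R42 := Matrix.toLin' (shearMatrix l m)

lemma shear_apply (l m : ℝ) (x : R42) : shear l m x =
    ![x 0 + (l * (x 3 + x 1) + m * (x 3 - x 1) + l * m * (x 0 - x 2)) / 2,
      x 1 + (m - l) * (x 0 - x 2) / 2,
      x 2 + (l * (x 3 + x 1) + m * (x 3 - x 1) + l * m * (x 0 - x 2)) / 2,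
      x 3 + (l + m) * (x 0 - x 2) / 2] := by
  ext i
  rw [shear, Matrix.toLin'_apply, Matrix.mulVec, dotProduct, Fin.sum_univ_four]
  fin_cases i <;> simp [shearMatrix] <;> ring

lemma isLinearMotion_shear (l m : ℝ) : IsLinearMotion (shear l m) := by
  refine ⟨fun x y => ?_, ?_⟩
  · simp [shear_apply, ip]
    ring
  · rw [shear, LinearMap.det_toLin']
    simp [shearMatrix, Matrix.det_succ_row_zero, Fin.sum_univ_succ, Fin.succAbove]
    ring

/-- `x₁ + x₃` is the upper left entry of the matrix `M` of `x`, so after the shear it equals `(1, l)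
M (1, m)ᵀ`. -/
lemma shear_zero_add_two (l m : ℝ) (x : R42) : shear l m x 0 + shear l m x 2 =
    x 0 + x 2 + l * (x 3 + x 1) + m * (x 3 - x 1) + l * m * (x 0 - x 2) := by
  simp [shear_apply]; ring

/-- The same formula for the inverse motion, with parameters `-l`, `-m`. -/
lemma zero_add_two_eq_shear (l m : ℝ) (x : R42) : x 0 + x 2 =
    shear l m x 0 + shear l m x 2 - l * (shear l m x 3 + shear l m x 1) -
      m * (shear l m x 3 - shear l m x 1) + l * m * (shear l m x 0 - shear l m x 2) := by
  simp [shear_apply]; ring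

lemma shear_injective (l m : ℝ) : Function.Injective (shear l m) := by
  rw [← LinearMap.ker_eq_bot, LinearMap.ker_eq_bot']
  intro x hx
  rw [shear_apply] at hx
  have h0 := congrFun hx 0
  have h1 := congrFun hx 1
  have h2 := congrFun hx 2
  have h3 := congrFun hx 3
  simp at h0 h1 h2 h3
  have h02 : x 0 - x 2 = 0 := by linarith
  have x1 : x 1 = 0 := by simpa [h02] using h1
  have x3 : x 3 = 0 := by simpa [h02] using h3
  have x0 : x 0 = 0 := by simpa [h02, x1, x3] using h0
  ext i
  fin_cases i
  exacts [x0, x1, by simpa [x0] using h02, x3]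

/-- `shear l m` as a continuous linear equivalence. -/
def shearEquiv (l m : ℝ) : R42 ≃L[ℝ] R42 :=
  (LinearEquiv.ofInjectiveEndo (shear l m) (shear_injective l m)).toContinuousLinearEquiv

lemma shearEquiv_apply (l m : ℝ) (x : R42) : shearEquiv l m x = shear l m x := rfl

/-- Given finitely many forbidden values, one for each of two conditions, a third remains. -/
lemma exists_avoid_two {P Q : ℝ → Prop} (hP : ∀ x y, P x → P y → x = y)
    (hQ : ∀ x y, Q x → Q y → x = y) : ∃ x, ¬ P x ∧ ¬ Q x := by
  -- Each condition excludes at most one of the values 0, 1, 2, so one of them is free.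
  by_contra! h
  by_cases h0 : P 0
  · have h1 : ¬ P 1 := fun h1 => by simpa using hP _ _ h0 h1
    have h2 : ¬ P 2 := fun h2 => by simpa using hP _ _ h0 h2
    simpa using hQ _ _ (h 1 h1) (h 2 h2)
  · by_cases h1 : P 1
    · have h2 : ¬ P 2 := fun h2 => by simpa using hP _ _ h1 h2
      simpa using hQ _ _ (h 0 h0) (h 2 h2)
    · simpa using hQ _ _ (h 0 h0) (h 1 h1)

/-- For fixed `m` the new height is affine in `l`, with coefficients the entries of `M (1, m)ᵀ`.
These vanish together for at most one `m`, since two values would force `M = 0`; and for any other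
`m` the height vanishes for at most one `l`. So two nonzero vectors can be handled at once. -/
lemma exists_shear_ne_zero {x y : R42} (hx : x ≠ 0) (hy : y ≠ 0) :
    ∃ l m : ℝ, shear l m x 0 + shear l m x 2 ≠ 0 ∧ shear l m y 0 + shear l m y 2 ≠ 0 := by
  have key : ∀ z : R42, z ≠ 0 → ∀ m m' : ℝ,
      (z 0 + z 2 + m * (z 3 - z 1) = 0 ∧ z 3 + z 1 + m * (z 0 - z 2) = 0) →
      (z 0 + z 2 + m' * (z 3 - z 1) = 0 ∧ z 3 + z 1 + m' * (z 0 - z 2) = 0) → m = m' := by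
    rintro z hz m m' ⟨h1, h2⟩ ⟨h3, h4⟩
    by_contra hne
    have hne := sub_ne_zero.2 hne
    have a1 : z 3 - z 1 = 0 :=
      (mul_eq_zero.1 (show (m - m') * (z 3 - z 1) = 0 by linarith)).resolve_left hne
    have a2 : z 0 - z 2 = 0 :=
      (mul_eq_zero.1 (show (m - m') * (z 0 - z 2) = 0 by linarith)).resolve_left hne
    rw [a1] at h1
    rw [a2] at h2
    apply hz
    ext i
    fin_cases i <;> simp <;> linarith
  obtain ⟨m, hmx, hmy⟩ := exists_avoid_two (key x hx) (key y hy)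
  have key' : ∀ z : R42,
      ¬ (z 0 + z 2 + m * (z 3 - z 1) = 0 ∧ z 3 + z 1 + m * (z 0 - z 2) = 0) → ∀ l l' : ℝ,
      shear l m z 0 + shear l m z 2 = 0 → shear l' m z 0 + shear l' m z 2 = 0 → l = l' := by
    intro z hz l l' h h'
    rw [shear_zero_add_two] at h h'
    by_contra hne
    have hne := sub_ne_zero.2 hne
    have a1 : z 3 + z 1 + m * (z 0 - z 2) = 0 :=
      (mul_eq_zero.1 (show (l - l') * (z 3 + z 1 + m * (z 0 - z 2)) = 0 by linarith)).resolve_left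
        hne
    refine hz ⟨?_, a1⟩
    have : l * (z 3 + z 1 + m * (z 0 - z 2)) = 0 := by rw [a1, mul_zero]
    linarith
  obtain ⟨l, hlx, hly⟩ := exists_avoid_two (key' x hmx) (key' y hmy)
  exact ⟨l, m, hlx, hly⟩

/-! ### The conjugate surface

On a Lorentzian surface the Hodge star on `1`-forms is induced by an involution of the tangent
planes, whose eigenspaces are the null directions. For a minimal surface `dΨ` composed with it is
closed, so it is locally the differential of a conjugate surface. -/

section Conjugate

variable (Ψ : ℝ × ℝ → R42)

/-- The area density. -/
def area (q : ℝ × ℝ) : ℝ := √(-gramDet Ψ q)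

/-- The image of `∂_u` under the Hodge involution. -/
def hodgeU (q : ℝ × ℝ) : ℝ × ℝ := (-coeffF Ψ q / area Ψ q, coeffE Ψ q / area Ψ q)

/-- The image of `∂_v` under the Hodge involution. -/
def hodgeV (q : ℝ × ℝ) : ℝ × ℝ := (-coeffG Ψ q / area Ψ q, coeffF Ψ q / area Ψ q)

/-- The differential of `Ψ` composed with the Hodge involution. -/
def conjForm (q : ℝ × ℝ) : ℝ × ℝ →L[ℝ] R42 :=
  (ContinuousLinearMap.fst ℝ ℝ ℝ).smulRight (fderiv ℝ Ψ q (hodgeU Ψ q)) +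
    (ContinuousLinearMap.snd ℝ ℝ ℝ).smulRight (fderiv ℝ Ψ q (hodgeV Ψ q))

variable {Ψ} {U : Set (ℝ × ℝ)} {q : ℝ × ℝ}

lemma conjForm_apply (X : ℝ × ℝ) :
    conjForm Ψ q X = fderiv ℝ Ψ q (X.1 • hodgeU Ψ q + X.2 • hodgeV Ψ q) := by
  simp [conjForm]

lemma ip_fderiv_fderiv (Ψ : ℝ × ℝ → R42) (q X Y : ℝ × ℝ) :
    ip (fderiv ℝ Ψ q X) (fderiv ℝ Ψ q Y) =
      X.1 * Y.1 * coeffE Ψ q + (X.1 * Y.2 + X.2 * Y.1) * coeffF Ψ q +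
        X.2 * Y.2 * coeffG Ψ q := by
  rw [fderiv_apply_eq, fderiv_apply_eq]
  simp only [ip_add_left, ip_add_right, ip_smul_left, ip_smul_right, ip_comm (dv Ψ q) (du Ψ q),
    coeffE, coeffF, coeffG]
  ring

section

variable (hl : gramDet Ψ q < 0)

include hl

lemma area_pos : 0 < area Ψ q := Real.sqrt_pos.2 (by linarith)

lemma area_sq : area Ψ q ^ 2 = coeffF Ψ q ^ 2 - coeffE Ψ q * coeffG Ψ q := by
  rw [area, Real.sq_sqrt (by linarith), gramDet]; ring

/-- The involution `J` satisfies `⟨JX,JX⟩ = -⟨X,X⟩` and `⟨X,JX⟩ = 0`, so the square of `X + cJX` is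
`(1 - c²)⟨X,X⟩`. -/
lemma null_of_conjForm (X : ℝ × ℝ) (c : ℝ) (hc : c ^ 2 = 1) :
    ip (fderiv ℝ Ψ q X + c • conjForm Ψ q X) (fderiv ℝ Ψ q X + c • conjForm Ψ q X) = 0 := by
  have hW := (area_pos hl).ne'
  have hW2 := area_sq hl
  rw [conjForm_apply, ← map_smul, ← map_add, ip_fderiv_fderiv]
  simp only [hodgeU, hodgeV, Prod.fst_add, Prod.snd_add, Prod.smul_fst, Prod.smul_snd, smul_eq_mul]
  field_simp
  generalize area Ψ q = W at *
  generalize coeffE Ψ q = E at *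
  generalize coeffF Ψ q = F at *
  generalize coeffG Ψ q = G at *
  linear_combination (-1 * (E * X.1 ^ 2 + 2 * F * X.1 * X.2 + G * X.2 ^ 2)) *
    (F ^ 2 - E * G) * hc + (E * X.1 ^ 2 + 2 * F * X.1 * X.2 + G * X.2 ^ 2) * hW2

end

variable (hU : IsOpen U) (hΨ : ContDiffOn ℝ ∞ Ψ U) (hl : ∀ q ∈ U, gramDet Ψ q < 0)

include hU hΨ hl

lemma contDiffOn_area : ContDiffOn ℝ ∞ (area Ψ) U :=
  (contDiffOn_gramDet hU hΨ).neg.sqrt fun q hq => by have := hl q hq; linarith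

lemma contDiffOn_hodgeU : ContDiffOn ℝ ∞ (hodgeU Ψ) U :=
  have hW := fun q hq => (area_pos (hl q hq)).ne'
  ((contDiffOn_coeffF hU hΨ).neg.div (contDiffOn_area hU hΨ hl) hW).prodMk
    ((contDiffOn_coeffE hU hΨ).div (contDiffOn_area hU hΨ hl) hW)

lemma contDiffOn_hodgeV : ContDiffOn ℝ ∞ (hodgeV Ψ) U :=
  have hW := fun q hq => (area_pos (hl q hq)).ne'
  ((contDiffOn_coeffG hU hΨ).neg.div (contDiffOn_area hU hΨ hl) hW).prodMk
    ((contDiffOn_coeffF hU hΨ).div (contDiffOn_area hU hΨ hl) hW)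

lemma contDiffOn_conjForm : ContDiffOn ℝ ∞ (conjForm Ψ) U :=
  ((ContinuousLinearMap.smulRightL ℝ (ℝ × ℝ) R42
      (ContinuousLinearMap.fst ℝ ℝ ℝ)).contDiff.comp_contDiffOn
      (contDiffOn_fderiv_apply hU hΨ (contDiffOn_hodgeU hU hΨ hl))).add
    ((ContinuousLinearMap.smulRightL ℝ (ℝ × ℝ) R42
      (ContinuousLinearMap.snd ℝ ℝ ℝ)).contDiff.comp_contDiffOn
      (contDiffOn_fderiv_apply hU hΨ (contDiffOn_hodgeV hU hΨ hl)))

/-- Half the derivative of `W² = F² - EG`. -/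
lemma area_mul_fderiv_area (hq : q ∈ U) (X : ℝ × ℝ) :
    area Ψ q * fderiv ℝ (area Ψ) q X =
      coeffF Ψ q * (ip (fderiv ℝ (du Ψ) q X) (dv Ψ q) + ip (du Ψ q) (fderiv ℝ (dv Ψ) q X)) -
        ip (fderiv ℝ (du Ψ) q X) (du Ψ q) * coeffG Ψ q -
        coeffE Ψ q * ip (fderiv ℝ (dv Ψ) q X) (dv Ψ q) := by
  have dW := (contDiffOn_area hU hΨ hl).differentiableAt_of_isOpen hU hq
  have dE := (contDiffOn_coeffE hU hΨ).differentiableAt_of_isOpen hU hq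
  have dF := (contDiffOn_coeffF hU hΨ).differentiableAt_of_isOpen hU hq
  have dG := (contDiffOn_coeffG hU hΨ).differentiableAt_of_isOpen hU hq
  have d1 : DifferentiableAt ℝ (du Ψ) q :=
    (contDiffOn_fderiv_const hU hΨ _).differentiableAt_of_isOpen hU hq
  have d2 : DifferentiableAt ℝ (dv Ψ) q :=
    (contDiffOn_fderiv_const hU hΨ _).differentiableAt_of_isOpen hU hq
  have hE : fderiv ℝ (coeffE Ψ) q X = 2 * ip (fderiv ℝ (du Ψ) q X) (du Ψ q) := by
    have := fderiv_ip d1 d1 X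
    rw [ip_comm (du Ψ q)] at this
    exact this.trans (by ring)
  have hG : fderiv ℝ (coeffG Ψ) q X = 2 * ip (fderiv ℝ (dv Ψ) q X) (dv Ψ q) := by
    have := fderiv_ip d2 d2 X
    rw [ip_comm (dv Ψ q)] at this
    exact this.trans (by ring)
  have hF := fderiv_ip d1 d2 X
  change fderiv ℝ (coeffF Ψ) q X = _ at hF
  have he : (fun x => area Ψ x * area Ψ x) =ᶠ[nhds q]
      fun x => coeffF Ψ x * coeffF Ψ x - coeffE Ψ x * coeffG Ψ x := by
    filter_upwards [hU.mem_nhds hq] with x hx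
    rw [← sq, area_sq (hl x hx), sq]
  have key := congrArg (fun T => T X) (he.fderiv_eq (𝕜 := ℝ))
  rw [fderiv_fun_mul dW dW, fderiv_fun_sub (dF.fun_mul dF) (dE.fun_mul dG), fderiv_fun_mul dF dF,
    fderiv_fun_mul dE dG] at key
  simp only [sub_apply, add_apply, smul_apply, smul_eq_mul, hE, hF, hG] at key
  linarith

/-- The form defining the conjugate surface is closed if the mean curvature vanishes. -/
lemma fderiv_hodge_symm (hq : q ∈ U) (hH : meanCurvature Ψ q = 0) :
    fderiv ℝ (fun x => fderiv ℝ Ψ x (hodgeV Ψ x)) q (1, 0) =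
      fderiv ℝ (fun x => fderiv ℝ Ψ x (hodgeU Ψ x)) q (0, 1) := by
  have hg : gramDet Ψ q ≠ 0 := (hl q hq).ne
  have hW := (area_pos (hl q hq)).ne'
  have hΨq := hΨ.contDiffAt (hU.mem_nhds hq)
  have cU := contDiffOn_hodgeU hU hΨ hl
  have cV := contDiffOn_hodgeV hU hΨ hl
  have dA := (contDiffOn_fderiv_apply hU hΨ cU).differentiableAt_of_isOpen hU hq
  have dB := (contDiffOn_fderiv_apply hU hΨ cV).differentiableAt_of_isOpen hU hq
  have d1 : DifferentiableAt ℝ (du Ψ) q :=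
    (contDiffOn_fderiv_const hU hΨ _).differentiableAt_of_isOpen hU hq
  have d2 : DifferentiableAt ℝ (dv Ψ) q :=
    (contDiffOn_fderiv_const hU hΨ _).differentiableAt_of_isOpen hU hq
  have hmix : fderiv ℝ (dv Ψ) q (1, 0) = fderiv ℝ (du Ψ) q (0, 1) :=
    fderiv_fderiv_apply_comm hΨq (1, 0) (0, 1)
  set A := fun x => fderiv ℝ Ψ x (hodgeU Ψ x) with hA
  set B := fun x => fderiv ℝ Ψ x (hodgeV Ψ x) with hB
  -- The products of `A` and `B` with `Ψ_u`, `Ψ_v` are only `0` or `±W`. Differentiating them gives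
  -- the tangential part of `B_u - A_v` without differentiating the Hodge coefficients.
  have ipA : ∀ x ∈ U, ip (A x) (du Ψ x) = 0 ∧ ip (A x) (dv Ψ x) = -area Ψ x := by
    intro x hx
    have hW := (area_pos (hl x hx)).ne'
    have hW2 := area_sq (hl x hx)
    simp only [hA, du, dv, ip_fderiv_fderiv, hodgeU]
    constructor
    · ring
    · field_simp; linarith
  have ipB : ∀ x ∈ U, ip (B x) (du Ψ x) = area Ψ x ∧ ip (B x) (dv Ψ x) = 0 := by
    intro x hx
    have hW := (area_pos (hl x hx)).ne'
    have hW2 := area_sq (hl x hx)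
    simp only [hB, du, dv, ip_fderiv_fderiv, hodgeV]
    constructor
    · field_simp; linarith
    · ring
  have eA1 : fderiv ℝ (fun x => ip (A x) (du Ψ x)) q = fderiv ℝ (fun _ => (0 : ℝ)) q :=
    Filter.EventuallyEq.fderiv_eq (by filter_upwards [hU.mem_nhds hq] with x hx using (ipA x hx).1)
  have eA2 : fderiv ℝ (fun x => ip (A x) (dv Ψ x)) q = fderiv ℝ (fun x => -area Ψ x) q :=
    Filter.EventuallyEq.fderiv_eq (by filter_upwards [hU.mem_nhds hq] with x hx using (ipA x hx).2)
  have eB1 : fderiv ℝ (fun x => ip (B x) (du Ψ x)) q = fderiv ℝ (fun x => area Ψ x) q :=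
    Filter.EventuallyEq.fderiv_eq (by filter_upwards [hU.mem_nhds hq] with x hx using (ipB x hx).1)
  have eB2 : fderiv ℝ (fun x => ip (B x) (dv Ψ x)) q = fderiv ℝ (fun _ => (0 : ℝ)) q :=
    Filter.EventuallyEq.fderiv_eq (by filter_upwards [hU.mem_nhds hq] with x hx using (ipB x hx).2)
  have fA1 := fderiv_ip dA d1 (0, 1)
  have fA2 := fderiv_ip dA d2 (0, 1)
  have fB1 := fderiv_ip dB d1 (1, 0)
  have fB2 := fderiv_ip dB d2 (1, 0)
  rw [eA1] at fA1
  rw [eA2, fderiv_fun_neg] at fA2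
  rw [eB1] at fB1
  rw [eB2] at fB2
  have hAq : ∀ w, ip (A q) w =
      (coeffE Ψ q * ip w (dv Ψ q) - coeffF Ψ q * ip w (du Ψ q)) / area Ψ q := by
    intro w
    simp only [hA, fderiv_apply_eq, hodgeU, ip_comm _ w, ip_add_right, ip_smul_right]
    ring
  have hBq : ∀ w, ip (B q) w =
      (coeffF Ψ q * ip w (dv Ψ q) - coeffG Ψ q * ip w (du Ψ q)) / area Ψ q := by
    intro w
    simp only [hB, fderiv_apply_eq, hodgeV, ip_comm _ w, ip_add_right, ip_smul_right]
    ring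
  have wu := area_mul_fderiv_area hU hΨ hl hq (1, 0)
  have wv := area_mul_fderiv_area hU hΨ hl hq (0, 1)
  rw [mul_comm, ← eq_div_iff hW] at wu wv
  have t1 : ip (fderiv ℝ B q (1, 0) - fderiv ℝ A q (0, 1)) (du Ψ q) = 0 := by
    rw [hBq] at fB1
    rw [hAq] at fA1
    simp only [zero_apply, fderiv_fun_const, Pi.zero_apply] at fA1
    rw [ip_sub_left, eq_sub_of_add_eq fB1.symm, eq_sub_of_add_eq fA1.symm, wu, hmix,
      ip_comm (du Ψ q)]
    ring
  have t2 : ip (fderiv ℝ B q (1, 0) - fderiv ℝ A q (0, 1)) (dv Ψ q) = 0 := by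
    rw [hBq] at fB2
    rw [hAq] at fA2
    simp only [zero_apply, fderiv_fun_const, Pi.zero_apply, neg_apply] at fB2 fA2
    rw [ip_sub_left, eq_sub_of_add_eq fB2.symm, eq_sub_of_add_eq fA2.symm, wv, hmix,
      ip_comm (du Ψ q)]
    ring
  -- The normal part is `σ(∂_u, *∂_v) - σ(∂_v, *∂_u)`, which is `-1/W` times the trace expression in
  -- `meanCurvature`.
  have hn : nor Ψ q (fderiv ℝ B q (1, 0) - fderiv ℝ A q (0, 1)) = 0 := by
    rw [sub_eq_add_neg, ← neg_one_smul ℝ (fderiv ℝ A q (0, 1)), nor_add, nor_smul,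
      nor_fderiv_tangent_field hΨq hg (cU.differentiableAt_of_isOpen hU hq),
      nor_fderiv_tangent_field hΨq hg (cV.differentiableAt_of_isOpen hU hq)]
    rw [meanCurvature, smul_eq_zero] at hH
    have hH := hH.resolve_left (by simpa using hg)
    have eU : hodgeU Ψ q = (area Ψ q)⁻¹ • (-coeffF Ψ q • (1, 0) + coeffE Ψ q • (0, 1)) := by
      ext <;> simp [hodgeU] <;> ring
    have eV : hodgeV Ψ q = (area Ψ q)⁻¹ • (-coeffG Ψ q • (1, 0) + coeffF Ψ q • (0, 1)) := by
      ext <;> simp [hodgeV] <;> ring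
    simp only [eU, eV, sff_smul_right hΨq, sff_add_right hΨq, sff_comm hΨq (0, 1) (1, 0)]
    have hH' := congrArg (fun x => -((area Ψ q)⁻¹ • x)) hH
    simp only [smul_zero, neg_zero] at hH'
    refine Eq.trans ?_ hH'
    module
  rw [nor, sub_eq_zero, tang, t1, t2] at hn
  simpa [sub_eq_zero] using hn

lemma fderiv_conjForm_symm (hq : q ∈ U) (hH : meanCurvature Ψ q = 0) (X Y : ℝ × ℝ) :
    fderiv ℝ (conjForm Ψ) q X Y = fderiv ℝ (conjForm Ψ) q Y X := by
  have dA := (contDiffOn_fderiv_apply hU hΨ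
    (contDiffOn_hodgeU hU hΨ hl)).differentiableAt_of_isOpen hU hq
  have dB := (contDiffOn_fderiv_apply hU hΨ
    (contDiffOn_hodgeV hU hΨ hl)).differentiableAt_of_isOpen hU hq
  have h : HasFDerivAt (conjForm Ψ) _ q :=
    (((ContinuousLinearMap.smulRightL ℝ (ℝ × ℝ) R42
      (ContinuousLinearMap.fst ℝ ℝ ℝ)).hasFDerivAt).comp q dA.hasFDerivAt).add
    (((ContinuousLinearMap.smulRightL ℝ (ℝ × ℝ) R42
      (ContinuousLinearMap.snd ℝ ℝ ℝ)).hasFDerivAt).comp q dB.hasFDerivAt)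
  have hs := fderiv_hodge_symm hU hΨ hl hq hH
  have hX : ∀ X : ℝ × ℝ, X = X.1 • ((1, 0) : ℝ × ℝ) + X.2 • ((0, 1) : ℝ × ℝ) := by
    intro X; ext <;> simp
  have hT : ∀ (T : ℝ × ℝ →L[ℝ] R42) (X : ℝ × ℝ), T X = X.1 • T (1, 0) + X.2 • T (0, 1) := by
    intro T X
    conv_lhs => rw [hX X]
    rw [map_add, map_smul, map_smul]
  have happ : ∀ X Y : ℝ × ℝ, fderiv ℝ (conjForm Ψ) q X Y =
      Y.1 • fderiv ℝ (fun x => fderiv ℝ Ψ x (hodgeU Ψ x)) q X +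
        Y.2 • fderiv ℝ (fun x => fderiv ℝ Ψ x (hodgeV Ψ x)) q X := by
    intro X Y
    rw [h.fderiv]
    rfl
  rw [happ, happ]
  rw [hT (fderiv ℝ (fun x => fderiv ℝ Ψ x (hodgeV Ψ x)) q) X,
    hT (fderiv ℝ (fun x => fderiv ℝ Ψ x (hodgeV Ψ x)) q) Y,
    hT (fderiv ℝ (fun x => fderiv ℝ Ψ x (hodgeU Ψ x)) q) X,
    hT (fderiv ℝ (fun x => fderiv ℝ Ψ x (hodgeU Ψ x)) q) Y, hs]
  module

/-- A minimal Lorentzian surface is locally a sum of two maps with null differentials. -/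
lemma exists_null_decomposition (hH : ∀ q ∈ U, meanCurvature Ψ q = 0) {p : ℝ × ℝ} (hp : p ∈ U) :
    ∃ (V : Set (ℝ × ℝ)) (B T : ℝ × ℝ → R42), IsOpen V ∧ p ∈ V ∧ V ⊆ U ∧
      ContDiffOn ℝ ∞ B V ∧ ContDiffOn ℝ ∞ T V ∧ (∀ q ∈ V, Ψ q = B q + T q) ∧
      (∀ q ∈ V, ∀ X, ∃ Y, fderiv ℝ B q X = fderiv ℝ Ψ q Y ∧
        ip (fderiv ℝ Ψ q Y) (fderiv ℝ Ψ q Y) = 0) ∧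
      (∀ q ∈ V, ∀ X, ∃ Y, fderiv ℝ T q X = fderiv ℝ Ψ q Y ∧
        ip (fderiv ℝ Ψ q Y) (fderiv ℝ Ψ q Y) = 0) := by
  obtain ⟨r, hr, hV⟩ := Metric.isOpen_iff.1 hU p hp
  have hω := (contDiffOn_conjForm hU hΨ hl).mono hV
  -- Poincaré lemma on a ball: the closed form is the differential of the conjugate surface `f`.
  obtain ⟨f, hf⟩ := (convex_ball p r).exists_forall_hasFDerivAt_of_fderiv_symmetric
    Metric.isOpen_ball (hω.differentiableOn (by simp))
    (fun q hq X Y => fderiv_conjForm_symm hU hΨ hl (hV hq) (hH q (hV hq)) X Y)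
  have hfs : ContDiffOn ℝ ∞ f (Metric.ball p r) := by
    rw [contDiffOn_infty_iff_fderiv_of_isOpen Metric.isOpen_ball]
    exact ⟨fun q hq => (hf q hq).differentiableAt.differentiableWithinAt,
      hω.congr fun q hq => (hf q hq).fderiv⟩
  have hΨs := hΨ.mono hV
  have dΨ : ∀ q ∈ Metric.ball p r, HasFDerivAt Ψ (fderiv ℝ Ψ q) q := fun q hq =>
    (hΨs.differentiableAt_of_isOpen Metric.isOpen_ball hq).hasFDerivAt
  -- `B` and `T` correspond to the two eigenvalues of the involution, so their differentials take
  -- values in the two null lines.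
  refine ⟨Metric.ball p r, fun q => (1 / 2 : ℝ) • (Ψ q + f q), fun q => (1 / 2 : ℝ) • (Ψ q - f q),
    Metric.isOpen_ball, Metric.mem_ball_self hr, hV, (hΨs.add hfs).const_smul (1 / 2 : ℝ),
    (hΨs.sub hfs).const_smul (1 / 2 : ℝ), fun q _ => by module, fun q hq X => ?_, fun q hq X => ?_⟩
  · have e : fderiv ℝ (fun q => (1 / 2 : ℝ) • (Ψ q + f q)) q X =
        (1 / 2 : ℝ) • (fderiv ℝ Ψ q X + (1 : ℝ) • conjForm Ψ q X) := by
      rw [(((dΨ q hq).fun_add (hf q hq)).fun_const_smul (1 / 2 : ℝ)).fderiv]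
      simp
    have hY : (1 / 2 : ℝ) • (fderiv ℝ Ψ q X + (1 : ℝ) • conjForm Ψ q X) = fderiv ℝ Ψ q
        ((1 / 2 : ℝ) • (X + (1 : ℝ) • (X.1 • hodgeU Ψ q + X.2 • hodgeV Ψ q))) := by
      simp only [conjForm_apply, map_add, map_smul]
    refine ⟨_, e.trans hY, ?_⟩
    rw [← hY, ip_smul_left, ip_smul_right, null_of_conjForm (hl q (hV hq)) X 1 (by norm_num)]
    simp
  · have e : fderiv ℝ (fun q => (1 / 2 : ℝ) • (Ψ q - f q)) q X =
        (1 / 2 : ℝ) • (fderiv ℝ Ψ q X + (-1 : ℝ) • conjForm Ψ q X) := by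
      rw [(((dΨ q hq).fun_sub (hf q hq)).fun_const_smul (1 / 2 : ℝ)).fderiv]
      simp [sub_eq_add_neg]
    have hY : (1 / 2 : ℝ) • (fderiv ℝ Ψ q X + (-1 : ℝ) • conjForm Ψ q X) = fderiv ℝ Ψ q
        ((1 / 2 : ℝ) • (X + (-1 : ℝ) • (X.1 • hodgeU Ψ q + X.2 • hodgeV Ψ q))) := by
      simp only [conjForm_apply, map_add, map_smul]
    refine ⟨_, e.trans hY, ?_⟩
    rw [← hY, ip_smul_left, ip_smul_right, null_of_conjForm (hl q (hV hq)) X (-1) (by norm_num)]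
    simp

end Conjugate

/-! ### Regular points -/

/-- The linear functional `x₁ + x₃`. -/
def height : R42 →L[ℝ] ℝ :=
  ContinuousLinearMap.proj (R := ℝ) (φ := fun _ : Fin 4 => ℝ) 0 +
    ContinuousLinearMap.proj (R := ℝ) (φ := fun _ : Fin 4 => ℝ) 2

lemma height_apply (w : R42) : height w = w 0 + w 2 := rfl

/-- The first fundamental form at the parameter vector whose image lies in `x₁ + x₃ = 0`. -/
def regDisc (Ψ : ℝ × ℝ → R42) (q : ℝ × ℝ) : ℝ :=
  coeffE Ψ q * height (dv Ψ q) ^ 2 - 2 * coeffF Ψ q * (height (du Ψ q) * height (dv Ψ q)) +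
    coeffG Ψ q * height (du Ψ q) ^ 2

section Regular

variable {Ψ : ℝ × ℝ → R42} {U : Set (ℝ × ℝ)} {q : ℝ × ℝ}

lemma height_fderiv (Ψ : ℝ × ℝ → R42) (q X : ℝ × ℝ) :
    height (fderiv ℝ Ψ q X) = X.1 * height (du Ψ q) + X.2 * height (dv Ψ q) := by
  rw [fderiv_apply_eq, map_add, map_smul, map_smul, smul_eq_mul, smul_eq_mul]

/-- A parameter vector of height zero is proportional to `(height Ψ_v, -height Ψ_u)` when that
vector is nonzero, and `regDisc` is the first fundamental form there. The two identities are the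
cleared form, valid also when both heights vanish. -/
lemma ip_mul_of_height_eq_zero {X : ℝ × ℝ} (hX : height (fderiv ℝ Ψ q X) = 0) :
    ip (fderiv ℝ Ψ q X) (fderiv ℝ Ψ q X) * height (du Ψ q) ^ 2 = X.2 ^ 2 * regDisc Ψ q ∧
    ip (fderiv ℝ Ψ q X) (fderiv ℝ Ψ q X) * height (dv Ψ q) ^ 2 = X.1 ^ 2 * regDisc Ψ q := by
  rw [height_fderiv] at hX
  rw [ip_fderiv_fderiv, regDisc]
  generalize height (du Ψ q) = l at *
  generalize height (dv Ψ q) = m at *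
  generalize coeffE Ψ q = E
  generalize coeffF Ψ q = F
  generalize coeffG Ψ q = G
  constructor
  · linear_combination (E * (X.1 * l - X.2 * m) + 2 * F * X.2 * l) * hX
  · linear_combination (G * (X.2 * m - X.1 * l) + 2 * F * X.1 * m) * hX

lemma exists_null_of_gramDet_neg (hq : gramDet Ψ q < 0) :
    ∃ X : ℝ × ℝ, X ≠ 0 ∧ ip (fderiv ℝ Ψ q X) (fderiv ℝ Ψ q X) = 0 := by
  by_cases hE : coeffE Ψ q = 0
  · exact ⟨(1, 0), by simp, by simp [ip_fderiv_fderiv, hE]⟩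
  · refine ⟨(area Ψ q - coeffF Ψ q, coeffE Ψ q), fun h => hE (congrArg Prod.snd h), ?_⟩
    rw [ip_fderiv_fderiv]
    linear_combination coeffE Ψ q * area_sq hq

/-- If `regDisc` vanishes, then `(height Ψ_v, -height Ψ_u)` is either a nonzero null vector of
height zero, or zero. In the latter case every tangent vector has height zero, and a Lorentzian
plane contains a nonzero null one. -/
lemma mem_regularPoints_iff (hl : ∀ q ∈ U, gramDet Ψ q < 0) :
    q ∈ regularPoints Ψ U ↔ q ∈ U ∧ regDisc Ψ q ≠ 0 := by
  constructor
  · rintro ⟨hq, h⟩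
    refine ⟨hq, fun h0 => ?_⟩
    have hX : (height (dv Ψ q), -height (du Ψ q)) = (0 : ℝ × ℝ) := by
      by_contra hne
      refine h _ hne ?_ ?_
      · rw [ip_fderiv_fderiv, ← h0, regDisc]; ring
      · rw [← height_apply, height_fderiv]; ring
    obtain ⟨X, hX0, hXn⟩ := exists_null_of_gramDet_neg (hl q hq)
    refine h X hX0 hXn ?_
    have h1 : height (dv Ψ q) = 0 := congrArg Prod.fst hX
    have h2 : height (du Ψ q) = 0 := neg_eq_zero.1 (congrArg Prod.snd hX)
    rw [← height_apply, height_fderiv, h1, h2, mul_zero, mul_zero, add_zero]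
  · rintro ⟨hq, h⟩
    refine ⟨hq, fun X hX0 hXn hXh => hX0 ?_⟩
    obtain ⟨h1, h2⟩ := ip_mul_of_height_eq_zero (Ψ := Ψ) (q := q) (X := X) hXh
    rw [hXn, zero_mul, zero_eq_mul] at h1 h2
    ext
    · simpa using h2.resolve_right h
    · simpa using h1.resolve_right h

lemma eq_zero_of_null_of_height_eq_zero (hq : q ∈ regularPoints Ψ U) {X : ℝ × ℝ}
    (hX : ip (fderiv ℝ Ψ q X) (fderiv ℝ Ψ q X) = 0) (h : height (fderiv ℝ Ψ q X) = 0) : X = 0 := by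
  by_contra hne
  exact hq.2 X hne hX h

lemma fderiv_injective (hq : gramDet Ψ q ≠ 0) {X : ℝ × ℝ} (hX : fderiv ℝ Ψ q X = 0) : X = 0 := by
  have h1 : ip (fderiv ℝ Ψ q X) (fderiv ℝ Ψ q (1, 0)) = 0 := by rw [hX, ip_zero_left]
  have h2 : ip (fderiv ℝ Ψ q X) (fderiv ℝ Ψ q (0, 1)) = 0 := by rw [hX, ip_zero_left]
  simp only [ip_fderiv_fderiv] at h1 h2
  have e1 : X.1 * gramDet Ψ q = 0 := by
    rw [gramDet]; linear_combination coeffG Ψ q * h1 - coeffF Ψ q * h2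
  have e2 : X.2 * gramDet Ψ q = 0 := by
    rw [gramDet]; linear_combination coeffE Ψ q * h2 - coeffF Ψ q * h1
  ext
  · simpa using (mul_eq_zero.1 e1).resolve_right hq
  · simpa using (mul_eq_zero.1 e2).resolve_right hq

lemma continuousOn_regDisc (hU : IsOpen U) (hΨ : ContDiffOn ℝ ∞ Ψ U) :
    ContinuousOn (regDisc Ψ) U := by
  have hE := (contDiffOn_coeffE hU hΨ).continuousOn
  have hF := (contDiffOn_coeffF hU hΨ).continuousOn
  have hG := (contDiffOn_coeffG hU hΨ).continuousOn
  have hu : ContinuousOn (fun q => height (du Ψ q)) U :=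
    height.continuous.comp_continuousOn (contDiffOn_fderiv_const hU hΨ _).continuousOn
  have hv : ContinuousOn (fun q => height (dv Ψ q)) U :=
    height.continuous.comp_continuousOn (contDiffOn_fderiv_const hU hΨ _).continuousOn
  exact ((hE.mul (hv.pow 2)).sub ((continuousOn_const.mul hF).mul (hu.mul hv))).add
    (hG.mul (hu.pow 2))

lemma isOpen_regularPoints (hU : IsOpen U) (hΨ : ContDiffOn ℝ ∞ Ψ U)
    (hl : ∀ q ∈ U, gramDet Ψ q < 0) : IsOpen (regularPoints Ψ U) := by
  have : regularPoints Ψ U = U ∩ regDisc Ψ ⁻¹' {0}ᶜ := by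
    ext q
    exact mem_regularPoints_iff hl
  rw [this]
  exact (continuousOn_regDisc hU hΨ).isOpen_inter_preimage hU isOpen_compl_singleton

end Regular

/-! ### Functions of `u + v` and of `u - v` -/

/-- The parameter domain `u + v ∈ (a, b)`, `u - v ∈ (c, d)`. -/
def box (a b c d : ℝ) : Set (ℝ × ℝ) := {q | q.1 + q.2 ∈ Ioo a b ∧ q.1 - q.2 ∈ Ioo c d}

section Box

variable {a b c d : ℝ}

lemma isOpen_box : IsOpen (box a b c d) :=
  (isOpen_Ioo.preimage (by fun_prop : Continuous fun q : ℝ × ℝ => q.1 + q.2)).inter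
    (isOpen_Ioo.preimage (by fun_prop : Continuous fun q : ℝ × ℝ => q.1 - q.2))

lemma convex_box : Convex ℝ (box a b c d) :=
  ((convex_Ioo a b).linear_preimage (LinearMap.fst ℝ ℝ ℝ + LinearMap.snd ℝ ℝ ℝ)).inter
    ((convex_Ioo c d).linear_preimage (LinearMap.fst ℝ ℝ ℝ - LinearMap.snd ℝ ℝ ℝ))

lemma mk_mem_box {t s : ℝ} (ht : t ∈ Ioo a b) (hs : s ∈ Ioo c d) :
    ((t + s) / 2, (t - s) / 2) ∈ box a b c d := by
  constructor
  · change (t + s) / 2 + (t - s) / 2 ∈ Ioo a b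
    rwa [show (t + s) / 2 + (t - s) / 2 = t by ring]
  · change (t + s) / 2 - (t - s) / 2 ∈ Ioo c d
    rwa [show (t + s) / 2 - (t - s) / 2 = s by ring]

variable {F : Type*} [NormedAddCommGroup F] [NormedSpace ℝ F]

lemma eq_of_fderiv_eq_zero_of_convex {E : Type*} [NormedAddCommGroup E] [NormedSpace ℝ E]
    {D : Set E} (hD : IsOpen D) (hc : Convex ℝ D) {G : E → F} (hG : DifferentiableOn ℝ G D) {w : E}
    (hw : ∀ q ∈ D, fderiv ℝ G q w = 0) {q : E} {r : ℝ} (hq : q ∈ D) (hr : q + r • w ∈ D) :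
    G (q + r • w) = G q := by
  have hmem : ∀ x ∈ Icc (0 : ℝ) 1, q + x • (r • w) ∈ D := fun x hx =>
    hc.add_smul_mem hq hr hx
  have hder : ∀ x ∈ Icc (0 : ℝ) 1, HasDerivAt (fun x : ℝ => G (q + x • (r • w))) 0 x := by
    intro x hx
    have h1 : HasDerivAt (fun x : ℝ => q + x • (r • w)) (r • w) x := by
      simpa using ((hasDerivAt_id x).smul_const (r • w)).const_add q
    have h2 := ((hG.differentiableAt (hD.mem_nhds (hmem x hx))).hasFDerivAt).comp_hasDerivAt x h1
    rwa [map_smul, hw _ (hmem x hx), smul_zero] at h2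
  have := constant_of_has_deriv_right_zero (a := (0 : ℝ)) (b := 1)
    (fun x hx => (hder x hx).continuousAt.continuousWithinAt)
    (fun x hx => (hder x (Ico_subset_Icc_self hx)).hasDerivWithinAt) 1 (by simp)
  simpa using this

/-- `G` is constant on the segments of direction `(1, -1)`, so `β` can be read off along a single
line `u - v = s`; `c < d` supplies such an `s`. -/
lemma exists_eq_comp_add {G : ℝ × ℝ → F} (hG : ContDiffOn ℝ ∞ G (box a b c d)) (hcd : c < d)
    (h : ∀ q ∈ box a b c d, fderiv ℝ G q (1, -1) = 0) :
    ∃ β : ℝ → F, ContDiffOn ℝ ∞ β (Ioo a b) ∧ ∀ q ∈ box a b c d, G q = β (q.1 + q.2) := by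
  obtain ⟨s, hs⟩ := nonempty_Ioo.2 hcd
  refine ⟨fun t => G ((t + s) / 2, (t - s) / 2), ?_, fun q hq => ?_⟩
  · refine hG.comp (ContDiff.contDiffOn ?_) fun t ht => mk_mem_box ht hs
    fun_prop
  · have e : ((q.1 + q.2 + s) / 2, (q.1 + q.2 - s) / 2) =
        q + ((s - (q.1 - q.2)) / 2) • ((1, -1) : ℝ × ℝ) := by
      ext <;> simp <;> ring
    have hm := mk_mem_box hq.1 hs
    simp only [e] at hm ⊢
    exact (eq_of_fderiv_eq_zero_of_convex isOpen_box convex_box (hG.differentiableOn (by simp)) h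
      hq hm).symm

lemma exists_eq_comp_sub {G : ℝ × ℝ → F} (hG : ContDiffOn ℝ ∞ G (box a b c d)) (hab : a < b)
    (h : ∀ q ∈ box a b c d, fderiv ℝ G q (1, 1) = 0) :
    ∃ θ : ℝ → F, ContDiffOn ℝ ∞ θ (Ioo c d) ∧ ∀ q ∈ box a b c d, G q = θ (q.1 - q.2) := by
  obtain ⟨t, ht⟩ := nonempty_Ioo.2 hab
  refine ⟨fun s => G ((t + s) / 2, (t - s) / 2), ?_, fun q hq => ?_⟩
  · refine hG.comp (ContDiff.contDiffOn ?_) fun s hs => mk_mem_box ht hs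
    fun_prop
  · have e : ((t + (q.1 - q.2)) / 2, (t - (q.1 - q.2)) / 2) =
        q + ((t - (q.1 + q.2)) / 2) • ((1, 1) : ℝ × ℝ) := by
      ext <;> simp <;> ring
    have hm := mk_mem_box ht hq.2
    simp only [e] at hm ⊢
    exact (eq_of_fderiv_eq_zero_of_convex isOpen_box convex_box (hG.differentiableOn (by simp)) h
      hq hm).symm

/-- The chain rule for `G ∘ φ = β (u + v) + θ (u - v)`. -/
lemma fderiv_comp_of_eq_add {G : ℝ × ℝ → F} {φ : ℝ × ℝ → ℝ × ℝ} {β θ : ℝ → F} {β' θ' : F}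
    {q : ℝ × ℝ} (hq : q ∈ box a b c d) (hφ : DifferentiableAt ℝ φ q)
    (hG : DifferentiableAt ℝ G (φ q)) (hβ : HasDerivAt β β' (q.1 + q.2))
    (hθ : HasDerivAt θ θ' (q.1 - q.2))
    (h : ∀ x ∈ box a b c d, G (φ x) = β (x.1 + x.2) + θ (x.1 - x.2)) (X : ℝ × ℝ) :
    fderiv ℝ G (φ q) (fderiv ℝ φ q X) = (X.1 + X.2) • β' + (X.1 - X.2) • θ' := by
  have h1 := hG.hasFDerivAt.comp q hφ.hasFDerivAt
  have hp : HasFDerivAt (fun x : ℝ × ℝ => x.1 + x.2)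
    (ContinuousLinearMap.fst ℝ ℝ ℝ + ContinuousLinearMap.snd ℝ ℝ ℝ) q :=
    hasFDerivAt_fst.add hasFDerivAt_snd
  have hm : HasFDerivAt (fun x : ℝ × ℝ => x.1 - x.2)
    (ContinuousLinearMap.fst ℝ ℝ ℝ - ContinuousLinearMap.snd ℝ ℝ ℝ) q :=
    hasFDerivAt_fst.sub hasFDerivAt_snd
  have h2 := (hβ.hasFDerivAt.comp q hp).add (hθ.hasFDerivAt.comp q hm)
  have he : G ∘ φ =ᶠ[nhds q] fun x => β (x.1 + x.2) + θ (x.1 - x.2) := by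
    filter_upwards [isOpen_box.mem_nhds hq] with x hx using h x hx
  have := congrArg (fun T => T X) (h1.unique (h2.congr_of_eventuallyEq he))
  simpa [add_smul, sub_smul] using this

end Box

/-! ### Null coordinates -/

lemma box_subset_ball (q : ℝ × ℝ) (r : ℝ) :
    box (q.1 + q.2 - r) (q.1 + q.2 + r) (q.1 - q.2 - r) (q.1 - q.2 + r) ⊆ Metric.ball q r := by
  rintro x ⟨⟨h1, h2⟩, h3, h4⟩
  rw [Metric.mem_ball, Prod.dist_eq, Real.dist_eq, Real.dist_eq, max_lt_iff, abs_lt, abs_lt]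
  refine ⟨⟨?_, ?_⟩, ?_, ?_⟩ <;> linarith

/-- Inverse function theorem, with a box as the domain of the inverse. -/
lemma exists_chart {χ : ℝ × ℝ → ℝ × ℝ} {V : Set (ℝ × ℝ)} (hV : IsOpen V)
    (hχ : ContDiffOn ℝ ∞ χ V) (hinj : ∀ q ∈ V, Function.Injective (fderiv ℝ χ q))
    {p : ℝ × ℝ} (hp : p ∈ V) :
    ∃ (a b c d : ℝ) (φ : OpenPartialHomeomorph (ℝ × ℝ) (ℝ × ℝ)),
      φ.source = box a b c d ∧ p ∈ φ.target ∧ φ.target ⊆ V ∧ ContDiffOn ℝ ∞ φ φ.source ∧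
      ContDiffOn ℝ ∞ φ.symm φ.target ∧ ∀ q ∈ φ.source, χ (φ q) = q := by
  have hd : ∀ q ∈ V, ∃ f' : (ℝ × ℝ) ≃L[ℝ] (ℝ × ℝ), HasFDerivAt χ (f' : ℝ × ℝ →L[ℝ] ℝ × ℝ) q :=
    fun q hq => ⟨(LinearEquiv.ofInjectiveEndo (fderiv ℝ χ q : ℝ × ℝ →ₗ[ℝ] ℝ × ℝ)
      (hinj q hq)).toContinuousLinearEquiv,
      (hχ.differentiableAt_of_isOpen hV hq).hasFDerivAt⟩
  obtain ⟨f', hf'⟩ := hd p hp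
  have hcd : ∀ q ∈ V, ContDiffAt ℝ ∞ χ q := fun q hq => hχ.contDiffAt (hV.mem_nhds hq)
  set e := ((hcd p hp).toOpenPartialHomeomorph χ hf' (by simp)).restrOpen V hV with he
  have hes : e.source ⊆ V := by
    rw [he, OpenPartialHomeomorph.restrOpen_source]
    exact inter_subset_right
  have hec : ∀ q, e q = χ q := fun q => rfl
  have hpe : p ∈ e.source := by
    rw [he, OpenPartialHomeomorph.restrOpen_source]
    exact ⟨(hcd p hp).mem_toOpenPartialHomeomorph_source hf' (by simp), hp⟩
  obtain ⟨r, hr, hball⟩ := Metric.isOpen_iff.1 e.open_target (χ p) (e.map_source hpe)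
  have hbox := (box_subset_ball (χ p) r).trans hball
  refine ⟨(χ p).1 + (χ p).2 - r, (χ p).1 + (χ p).2 + r, (χ p).1 - (χ p).2 - r,
    (χ p).1 - (χ p).2 + r, e.symm.restrOpen
    (box ((χ p).1 + (χ p).2 - r) ((χ p).1 + (χ p).2 + r) ((χ p).1 - (χ p).2 - r)
      ((χ p).1 - (χ p).2 + r)) isOpen_box, ?_, ?_, ?_, ?_, ?_, ?_⟩
  · rw [OpenPartialHomeomorph.restrOpen_source]
    exact inter_eq_self_of_subset_right hbox
  · refine ⟨hpe, ?_⟩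
    change e p ∈ box _ _ _ _
    rw [hec]
    constructor <;> constructor <;> linarith
  · exact fun q hq => hes hq.1
  -- The derivative of `χ` is invertible on all of `V`, so the inverse is smooth on the whole box
  -- and not only at the image of `p`.
  · intro q hq
    have hqt : q ∈ e.target := hq.1
    obtain ⟨g', hg'⟩ := hd _ (hes (e.map_target hqt))
    exact (e.contDiffAt_symm hqt hg' (hcd _ (hes (e.map_target hqt)))).contDiffWithinAt
  · exact hχ.mono fun q hq => hes hq.1
  · intro q hq
    exact e.right_inv hq.1

section NullChart

variable {Ψ : ℝ × ℝ → R42} {U : Set (ℝ × ℝ)} {p : ℝ × ℝ}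
  (hU : IsOpen U) (hΨ : ContDiffOn ℝ ∞ Ψ U) (hl : ∀ q ∈ U, gramDet Ψ q < 0)
  (hH : ∀ q ∈ U, meanCurvature Ψ q = 0)

include hU hΨ hl hH

/-- Near a regular point, a minimal Lorentzian surface is a translation surface of two null
curves, parametrized by their height. -/
lemma exists_null_chart (hp : p ∈ regularPoints Ψ U) :
    ∃ (a b c d ε : ℝ) (φ : OpenPartialHomeomorph (ℝ × ℝ) (ℝ × ℝ)) (β θ : ℝ → R42),
      ε ^ 2 = 1 ∧ φ.source = box a b c d ∧ p ∈ φ.target ∧ φ.target ⊆ U ∧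
      ContDiffOn ℝ ∞ φ φ.source ∧ ContDiffOn ℝ ∞ φ.symm φ.target ∧
      (∀ q ∈ φ.source, Ψ (φ q) = β (q.1 + q.2) + θ (q.1 - q.2)) ∧
      ContDiffOn ℝ ∞ β (Ioo a b) ∧ ContDiffOn ℝ ∞ θ (Ioo c d) ∧
      (∀ t ∈ Ioo a b, ip (deriv β t) (deriv β t) = 0 ∧ height (deriv β t) = 1) ∧
      (∀ s ∈ Ioo c d, ip (deriv θ s) (deriv θ s) = 0 ∧ height (deriv θ s) = ε) ∧
      ∀ t ∈ Ioo a b, ∀ s ∈ Ioo c d, 0 < ip (deriv β t) (deriv θ s) := by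
  obtain ⟨V, B, T, hV, hpV, hVU, hB, hT, hsum, hBn, hTn⟩ :=
    exists_null_decomposition hU hΨ hl hH hp.1
  -- The sign `ε` fixes the direction in which `θ` is traversed, so that `⟨β',θ'⟩ > 0`, that is `E >
  -- 0`. It persists on the neighbourhood `V'`.
  obtain ⟨ε, hε, hεp⟩ : ∃ ε : ℝ, ε ^ 2 = 1 ∧ ε * regDisc Ψ p < 0 := by
    rcases lt_or_gt_of_ne ((mem_regularPoints_iff hl).1 hp).2 with h | h
    · exact ⟨1, by norm_num, by linarith⟩
    · exact ⟨-1, by norm_num, by linarith⟩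
  set V' := V ∩ {q | q ∈ U ∧ ε * regDisc Ψ q < 0} with hV'
  have hV'o : IsOpen V' := by
    refine hV.inter ?_
    exact (continuousOn_const.mul (continuousOn_regDisc hU hΨ)).isOpen_inter_preimage hU isOpen_Iio
  have hreg : ∀ q ∈ V', q ∈ regularPoints Ψ U := by
    rintro q ⟨_, hq, hd⟩
    refine (mem_regularPoints_iff hl).2 ⟨hq, ?_⟩
    rintro h0
    rw [h0, mul_zero] at hd
    exact lt_irrefl _ hd
  have dB : ∀ q ∈ V', DifferentiableAt ℝ B q := fun q hq => hB.differentiableAt_of_isOpen hV hq.1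
  have dT : ∀ q ∈ V', DifferentiableAt ℝ T q := fun q hq => hT.differentiableAt_of_isOpen hV hq.1
  -- At regular points a null tangent vector of height zero vanishes, so `dB` vanishes on the kernel
  -- of `d(height B)`; the same holds for `T`.
  have hB0 : ∀ q ∈ V', ∀ X, height (fderiv ℝ B q X) = 0 → fderiv ℝ B q X = 0 := by
    intro q hq X hX
    obtain ⟨Y, hY, hYn⟩ := hBn q hq.1 X
    rw [hY] at hX ⊢
    rw [eq_zero_of_null_of_height_eq_zero (hreg q hq) hYn hX, map_zero]
  have hT0 : ∀ q ∈ V', ∀ X, height (fderiv ℝ T q X) = 0 → fderiv ℝ T q X = 0 := by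
    intro q hq X hX
    obtain ⟨Y, hY, hYn⟩ := hTn q hq.1 X
    rw [hY] at hX ⊢
    rw [eq_zero_of_null_of_height_eq_zero (hreg q hq) hYn hX, map_zero]
  have dsum : ∀ q ∈ V', ∀ X, fderiv ℝ Ψ q X = fderiv ℝ B q X + fderiv ℝ T q X := by
    intro q hq X
    have : Ψ =ᶠ[nhds q] fun x => B x + T x := by
      filter_upwards [hV.mem_nhds hq.1] with x hx using hsum x hx
    rw [this.fderiv_eq, fderiv_fun_add (dB q hq) (dT q hq)]
    rfl
  -- Coordinates with `u + v = height B` and `u - v = ε height T`. A vector killed by `dχ` is killed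
  -- by `dB` and `dT`, hence by `dΨ`.
  set χ : ℝ × ℝ → ℝ × ℝ := fun q =>
    ((height (B q) + ε * height (T q)) / 2, (height (B q) - ε * height (T q)) / 2) with hχdef
  have hχ : ContDiffOn ℝ ∞ χ V' := by
    have h1 : ContDiffOn ℝ ∞ (fun q => height (B q)) V' :=
      height.contDiff.comp_contDiffOn (hB.mono inter_subset_left)
    have h2 : ContDiffOn ℝ ∞ (fun q => ε * height (T q)) V' :=
      contDiffOn_const.mul (height.contDiff.comp_contDiffOn (hT.mono inter_subset_left))
    exact ((h1.add h2).div_const 2).prodMk ((h1.sub h2).div_const 2)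
  have hinj : ∀ q ∈ V', Function.Injective (fderiv ℝ χ q) := by
    intro q hq
    rw [injective_iff_map_eq_zero]
    intro X hX
    have h1 : HasFDerivAt (fun q => height (B q)) (height.comp (fderiv ℝ B q)) q :=
      height.hasFDerivAt.comp q (dB q hq).hasFDerivAt
    have h2 : HasFDerivAt (fun q => height (T q)) (height.comp (fderiv ℝ T q)) q :=
      height.hasFDerivAt.comp q (dT q hq).hasFDerivAt
    have hd := hχ.differentiableAt_of_isOpen hV'o hq
    have e1 : (fun q => height (B q)) = fun q => (χ q).1 + (χ q).2 := by
      funext q; simp only [hχdef]; ring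
    have e2 : (fun q => height (T q)) = fun q => ε * ((χ q).1 - (χ q).2) := by
      funext q
      have : ε * ε = 1 := by rw [← sq, hε]
      simp only [hχdef]
      linear_combination (-height (T q)) * this
    rw [e1] at h1
    rw [e2] at h2
    have k1 := congrArg (fun T => T X) (h1.unique (hd.hasFDerivAt.fst.add hd.hasFDerivAt.snd))
    have k2 := congrArg (fun T => T X)
      (h2.unique ((hd.hasFDerivAt.fst.sub hd.hasFDerivAt.snd).const_mul ε))
    simp [hX] at k1 k2
    apply fderiv_injective (hl q hq.2.1).ne
    rw [dsum q hq, hB0 q hq X k1, hT0 q hq X k2, add_zero]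
  obtain ⟨a, b, c, d, φ, hs, hpt, htV, hφ, hφs, hχφ⟩ := exists_chart hV'o hχ hinj ⟨hpV, hp.1, hεp⟩
  have hmem : φ.symm p ∈ box a b c d := hs ▸ φ.map_target hpt
  have hab : a < b := hmem.1.1.trans hmem.1.2
  have hcd : c < d := hmem.2.1.trans hmem.2.2
  rw [hs] at hφ hχφ
  have hφV : ∀ q ∈ box a b c d, φ q ∈ V' := fun q hq => htV (φ.map_source (hs ▸ hq))
  have dφ : ∀ q ∈ box a b c d, DifferentiableAt ℝ φ q := fun q hq =>
    hφ.differentiableAt_of_isOpen isOpen_box hq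
  have hheightB : ∀ q ∈ box a b c d, height (B (φ q)) = q.1 + q.2 := by
    intro q hq
    have h := hχφ q hq
    rw [← congrArg Prod.fst h, ← congrArg Prod.snd h]
    simp only [hχdef]; ring
  have hheightT : ∀ q ∈ box a b c d, height (T (φ q)) = ε * (q.1 - q.2) := by
    intro q hq
    have h := hχφ q hq
    have hεε : ε * ε = 1 := by rw [← sq, hε]
    rw [← congrArg Prod.fst h, ← congrArg Prod.snd h]
    simp only [hχdef]
    linear_combination (-height (T (φ q))) * hεε
  have hdB : ∀ q ∈ box a b c d, ∀ X : ℝ × ℝ,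
      height (fderiv ℝ B (φ q) (fderiv ℝ φ q X)) = X.1 + X.2 := by
    intro q hq X
    have hh : DifferentiableAt ℝ (fun x => height (B x)) (φ q) :=
      height.differentiableAt.comp _ (dB _ (hφV q hq))
    have h := fderiv_comp_of_eq_add (β := fun t => t) (θ := fun _ => (0 : ℝ)) hq (dφ q hq) hh
      (hasDerivAt_id _) (hasDerivAt_const _ _) (fun x hx => by rw [hheightB x hx, add_zero]) X
    rw [fderiv_fun_comp _ height.differentiableAt (dB _ (hφV q hq))] at h
    simpa using h
  have hdT : ∀ q ∈ box a b c d, ∀ X : ℝ × ℝ,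
      height (fderiv ℝ T (φ q) (fderiv ℝ φ q X)) = ε * (X.1 - X.2) := by
    intro q hq X
    have hh : DifferentiableAt ℝ (fun x => height (T x)) (φ q) :=
      height.differentiableAt.comp _ (dT _ (hφV q hq))
    have h := fderiv_comp_of_eq_add (β := fun _ => (0 : ℝ)) (θ := fun s => ε * s) hq (dφ q hq) hh
      (hasDerivAt_const _ _) ((hasDerivAt_id _).const_mul ε)
      (fun x hx => by rw [hheightT x hx, zero_add]) X
    rw [fderiv_fun_comp _ height.differentiableAt (dT _ (hφV q hq))] at h
    simp at h
    rw [h]; ring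
  have cB : ContDiffOn ℝ ∞ (fun q => B (φ q)) (box a b c d) :=
    hB.comp hφ fun q hq => (hφV q hq).1
  have cT : ContDiffOn ℝ ∞ (fun q => T (φ q)) (box a b c d) :=
    hT.comp hφ fun q hq => (hφV q hq).1
  obtain ⟨β, hβ, hBβ⟩ := exists_eq_comp_add cB hcd fun q hq => by
    rw [fderiv_fun_comp _ (dB _ (hφV q hq)) (dφ q hq)]
    exact hB0 _ (hφV q hq) _ ((hdB q hq _).trans (by norm_num))
  obtain ⟨θ, hθ, hTθ⟩ := exists_eq_comp_sub cT hab fun q hq => by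
    rw [fderiv_fun_comp _ (dT _ (hφV q hq)) (dφ q hq)]
    exact hT0 _ (hφV q hq) _ ((hdT q hq _).trans (by norm_num))
  have hβd : ∀ t ∈ Ioo a b, HasDerivAt β (deriv β t) t := fun t ht =>
    (hβ.differentiableAt_of_isOpen isOpen_Ioo ht).hasDerivAt
  have hθd : ∀ s ∈ Ioo c d, HasDerivAt θ (deriv θ s) s := fun s hs =>
    (hθ.differentiableAt_of_isOpen isOpen_Ioo hs).hasDerivAt
  have fB : ∀ q ∈ box a b c d, ∀ X : ℝ × ℝ,
      fderiv ℝ B (φ q) (fderiv ℝ φ q X) = (X.1 + X.2) • deriv β (q.1 + q.2) := by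
    intro q hq X
    have := fderiv_comp_of_eq_add (θ := fun _ => (0 : R42)) hq (dφ q hq) (dB _ (hφV q hq))
      (hβd _ hq.1) (hasDerivAt_const _ _) (fun x hx => by rw [hBβ x hx, add_zero]) X
    simpa using this
  have fT : ∀ q ∈ box a b c d, ∀ X : ℝ × ℝ,
      fderiv ℝ T (φ q) (fderiv ℝ φ q X) = (X.1 - X.2) • deriv θ (q.1 - q.2) := by
    intro q hq X
    have := fderiv_comp_of_eq_add (β := fun _ => (0 : R42)) hq (dφ q hq) (dT _ (hφV q hq))
      (hasDerivAt_const _ _) (hθd _ hq.2) (fun x hx => by rw [hTθ x hx, zero_add]) X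
    simpa using this
  obtain ⟨t₀, ht₀⟩ := nonempty_Ioo.2 hab
  obtain ⟨s₀, hs₀⟩ := nonempty_Ioo.2 hcd
  have hfst : ∀ t s : ℝ, (t + s) / 2 + (t - s) / 2 = t := fun t s => by ring
  have hsnd : ∀ t s : ℝ, (t + s) / 2 - (t - s) / 2 = s := fun t s => by ring
  have hβ' : ∀ t ∈ Ioo a b, ip (deriv β t) (deriv β t) = 0 ∧ height (deriv β t) = 1 := by
    intro t ht
    have hq := mk_mem_box ht hs₀
    have h := fB _ hq (1 / 2, 1 / 2)
    have h' := hdB _ hq (1 / 2, 1 / 2)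
    norm_num [hfst] at h h'
    obtain ⟨Y, hY, hYn⟩ := hBn _ (hφV _ hq).1 (fderiv ℝ φ ((t + s₀) / 2, (t - s₀) / 2) (1 / 2, 1 / 2))
    norm_num at hY
    rw [← h]
    exact ⟨by rw [hY, hYn], h'⟩
  have hθ' : ∀ s ∈ Ioo c d, ip (deriv θ s) (deriv θ s) = 0 ∧ height (deriv θ s) = ε := by
    intro s hs
    have hq := mk_mem_box ht₀ hs
    have h := fT _ hq (1 / 2, -1 / 2)
    have h' := hdT _ hq (1 / 2, -1 / 2)
    norm_num [hsnd] at h h'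
    obtain ⟨Y, hY, hYn⟩ := hTn _ (hφV _ hq).1 (fderiv ℝ φ ((t₀ + s) / 2, (t₀ - s) / 2) (1 / 2, -1 / 2))
    norm_num at hY
    rw [← h]
    exact ⟨by rw [hY, hYn], h'⟩
  refine ⟨a, b, c, d, ε, φ, β, θ, hε, hs, hpt, fun q hq => (htV hq).2.1, hs ▸ hφ, hφs,
    fun q hq => ?_, hβ, hθ, hβ', hθ', fun t ht s hs' => ?_⟩
  · rw [hs] at hq
    rw [hsum _ (hφV q hq).1, ← hBβ q hq, ← hTθ q hq]
  · have hq := mk_mem_box ht hs'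
    have hqV := hφV _ hq
    set q : ℝ × ℝ := ((t + s) / 2, (t - s) / 2) with hqdef
    have hqt : q.1 + q.2 = t := hfst t s
    have hqs : q.1 - q.2 = s := hsnd t s
    -- Chosen so that `dΨ Z = β' - εθ'`, whose height is `1 - ε² = 0`. Its square `-2ε⟨β',θ'⟩` then
    -- has the sign of `regDisc`, which is opposite to that of `ε`.
    set Z := fderiv ℝ φ q ((1 - ε) / 2, (1 + ε) / 2) with hZ
    have hBZ : fderiv ℝ B (φ q) Z = deriv β t := by
      rw [hZ, fB q hq, hqt]
      have : (1 - ε) / 2 + (1 + ε) / 2 = 1 := by ring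
      simp only [this, one_smul]
    have hTZ : fderiv ℝ T (φ q) Z = -ε • deriv θ s := by
      rw [hZ, fT q hq, hqs]
      have : (1 - ε) / 2 - (1 + ε) / 2 = -ε := by ring
      simp only [this]
    have hΨZ : fderiv ℝ Ψ (φ q) Z = deriv β t + -ε • deriv θ s := by
      rw [dsum _ hqV, hBZ, hTZ]
    have hZh : height (fderiv ℝ Ψ (φ q) Z) = 0 := by
      rw [hΨZ, map_add, map_smul, (hβ' t ht).2, (hθ' s hs').2, smul_eq_mul]
      linarith
    have hZ0 : Z ≠ 0 := by
      intro h0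
      have := (hβ' t ht).2
      rw [← hBZ, h0, map_zero, map_zero] at this
      norm_num at this
    obtain ⟨h1, h2⟩ := ip_mul_of_height_eq_zero hZh
    have hip : ip (fderiv ℝ Ψ (φ q) Z) (fderiv ℝ Ψ (φ q) Z) =
        -2 * ε * ip (deriv β t) (deriv θ s) := by
      rw [hΨZ]
      simp only [ip_add_left, ip_add_right, ip_smul_left, ip_smul_right, (hβ' t ht).1,
        (hθ' s hs').1, ip_comm (deriv θ s) (deriv β t)]
      ring
    rw [hip] at h1 h2
    have hZpos : 0 < Z.1 ^ 2 + Z.2 ^ 2 := by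
      by_contra hneg
      have := sq_nonneg Z.1
      have := sq_nonneg Z.2
      apply hZ0
      ext
      · exact pow_eq_zero_iff two_ne_zero |>.1 (by linarith)
      · exact pow_eq_zero_iff two_ne_zero |>.1 (by linarith)
    have key : 2 * ip (deriv β t) (deriv θ s) *
        (height (du Ψ (φ q)) ^ 2 + height (dv Ψ (φ q)) ^ 2) =
        -((Z.1 ^ 2 + Z.2 ^ 2) * (ε * regDisc Ψ (φ q))) := by
      linear_combination (-ε) * h1 - ε * h2 - 2 * ip (deriv β t) (deriv θ s) *
        (height (du Ψ (φ q)) ^ 2 + height (dv Ψ (φ q)) ^ 2) * hε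
    have hpos : 0 < -((Z.1 ^ 2 + Z.2 ^ 2) * (ε * regDisc Ψ (φ q))) :=
      neg_pos.2 (mul_neg_of_pos_of_neg hZpos hqV.2.2)
    rw [← key] at hpos
    have := pos_of_mul_pos_left hpos (by positivity)
    linarith

end NullChart

/-! ### The Weierstrass representation -/

/-- The height of `f • wVec g h` is `2f`, so `f = ε/2`, and the second and fourth coordinates then
determine `g` and `h`. Nullity supplies the value of `gh` that the other two coordinates need. -/
lemma smul_wVec_eq {w : R42} {ε : ℝ} (hε : ε ^ 2 = 1) (hw : ip w w = 0) (hh : height w = ε) :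
    (ε / 2) • wVec (ε * (w 1 + w 3)) (ε * (w 3 - w 1)) = w := by
  rw [height_apply] at hh
  rw [ip] at hw
  have hP : ε * (w 1 + w 3) * (ε * (w 3 - w 1)) = 2 * ε * w 0 - 1 := by
    linear_combination (w 3 ^ 2 - w 1 ^ 2 - 1) * hε - hw + (w 0 - w 2 - ε) * hh
  ext i
  fin_cases i
  · change ε / 2 * (1 + ε * (w 1 + w 3) * (ε * (w 3 - w 1))) = w 0
    linear_combination ε / 2 * hP + w 0 * hε
  · change ε / 2 * (ε * (w 1 + w 3) - ε * (w 3 - w 1)) = w 1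
    linear_combination w 1 * hε
  · change ε / 2 * (1 - ε * (w 1 + w 3) * (ε * (w 3 - w 1))) = w 2
    linear_combination -(ε / 2) * hP - w 0 * hε - hh
  · change ε / 2 * (ε * (w 1 + w 3) + ε * (w 3 - w 1)) = w 3
    linear_combination w 3 * hε

lemma ip_smul_wVec (f g h f' g' h' : ℝ) :
    ip (f • wVec g h) (f' • wVec g' h') = 2 * (f * f' * ((g - g') * (h - h'))) := by
  simp [ip, wVec]
  ring

lemma ip_self_of_height_eq_zero {w : R42} (hw : height w = 0) :
    ip w w = -((w 1 + w 3) * (w 3 - w 1)) := by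
  rw [height_apply] at hw
  rw [ip]
  linear_combination (w 0 - w 2) * hw

lemma exists_coord_of_null {Ψ : ℝ × ℝ → R42} {q M N : ℝ × ℝ}
    (hM : ip (fderiv ℝ Ψ q M) (fderiv ℝ Ψ q M) = 0) (hMN : ip (fderiv ℝ Ψ q M) (fderiv ℝ Ψ q N) ≠ 0)
    (Z : ℝ × ℝ) : ∃ a b : ℝ, Z = a • M + b • N := by
  have hdet : M.1 * N.2 - M.2 * N.1 ≠ 0 := by
    intro h0
    have : ip (fderiv ℝ Ψ q M) (fderiv ℝ Ψ q N) ^ 2 = -(M.1 * N.2 - M.2 * N.1) ^ 2 * gramDet Ψ q +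
        ip (fderiv ℝ Ψ q M) (fderiv ℝ Ψ q M) * ip (fderiv ℝ Ψ q N) (fderiv ℝ Ψ q N) := by
      simp only [ip_fderiv_fderiv, gramDet]; ring
    rw [h0, hM] at this
    exact hMN (by simpa using this)
  refine ⟨(Z.1 * N.2 - Z.2 * N.1) / (M.1 * N.2 - M.2 * N.1),
    (M.1 * Z.2 - M.2 * Z.1) / (M.1 * N.2 - M.2 * N.1), ?_⟩
  ext
  · simp only [Prod.fst_add, Prod.smul_fst, smul_eq_mul]
    rw [div_mul_eq_mul_div, div_mul_eq_mul_div, ← add_div, eq_div_iff hdet]; ring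
  · simp only [Prod.snd_add, Prod.smul_snd, smul_eq_mul]
    rw [div_mul_eq_mul_div, div_mul_eq_mul_div, ← add_div, eq_div_iff hdet]; ring

/-- A vector orthogonal to a null tangent direction has the same square as its normal part. -/
lemma ip_nor_nor_of_orthogonal_null {Ψ : ℝ × ℝ → R42} {q M N : ℝ × ℝ} (hq : gramDet Ψ q ≠ 0)
    (hM : ip (fderiv ℝ Ψ q M) (fderiv ℝ Ψ q M) = 0) (hMN : ip (fderiv ℝ Ψ q M) (fderiv ℝ Ψ q N) ≠ 0)
    {w : R42} (hw : ip w (fderiv ℝ Ψ q M) = 0) : ip (nor Ψ q w) (nor Ψ q w) = ip w w := by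
  obtain ⟨a, b, hab⟩ := exists_coord_of_null hM hMN (tangCoef Ψ q w)
  have ht : tang Ψ q w = a • fderiv ℝ Ψ q M + b • fderiv ℝ Ψ q N := by
    rw [tang_eq, hab, map_add, map_smul, map_smul]
  -- In a Lorentzian plane only multiples of `M` are orthogonal to the null vector `M`. The
  -- tangential part of `w` is therefore a multiple of `M`, orthogonal to `w`.
  have hb : b = 0 := by
    have h := ip_tang hq w M
    rw [ht, hw, ip_add_left, ip_smul_left, ip_smul_left, hM, ip_comm, mul_zero, zero_add] at h
    exact (mul_eq_zero.1 h).resolve_right hMN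
  rw [ip_nor_nor hq, nor, ip_sub_left, ht, hb, zero_smul, add_zero, ip_smul_left,
    ip_comm (fderiv ℝ Ψ q M), hw]
  ring

lemma deriv_coord {f : ℝ → R42} {t : ℝ} (hf : DifferentiableAt ℝ f t) (ε : ℝ) :
    deriv (fun x => ε * (f x 1 + f x 3)) t = ε * (deriv f t 1 + deriv f t 3) ∧
    deriv (fun x => ε * (f x 3 - f x 1)) t = ε * (deriv f t 3 - deriv f t 1) := by
  have h := hasDerivAt_pi.1 hf.hasDerivAt
  exact ⟨(((h 1).add (h 3)).const_mul ε).deriv, (((h 3).sub (h 1)).const_mul ε).deriv⟩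

lemma height_deriv {f : ℝ → R42} {I : Set ℝ} (hI : IsOpen I) (hf : DifferentiableOn ℝ f I) {ε : ℝ}
    (h : ∀ t ∈ I, height (f t) = ε) {t : ℝ} (ht : t ∈ I) : height (deriv f t) = 0 := by
  have hd := height.hasFDerivAt.comp_hasDerivAt t
    (hf.differentiableAt (hI.mem_nhds ht)).hasDerivAt
  have he : (height ∘ f) =ᶠ[nhds t] fun _ => ε := by
    filter_upwards [hI.mem_nhds ht] with x hx using h x hx
  exact hd.unique ((hasDerivAt_const t ε).congr_of_eventuallyEq he)

lemma ip_deriv_of_null {f : ℝ → R42} {I : Set ℝ} (hI : IsOpen I) (hf : DifferentiableOn ℝ f I)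
    (h : ∀ t ∈ I, ip (f t) (f t) = 0) {t : ℝ} (ht : t ∈ I) : ip (deriv f t) (f t) = 0 := by
  have hd := hf.differentiableAt (hI.mem_nhds ht)
  have := fderiv_ip_eq_zero hd hd (by filter_upwards [hI.mem_nhds ht] with x hx using h x hx) 1
  rw [fderiv_apply_one_eq_deriv, ip_comm (f t)] at this
  linarith

theorem hasWeierstrassRep_of_mem_regularPoints {Ψ : ℝ × ℝ → R42} {U : Set (ℝ × ℝ)}
    (hS : IsMinimalLorentzianGeneralType Ψ U) {p : ℝ × ℝ} (hp : p ∈ regularPoints Ψ U) :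
    HasWeierstrassRep Ψ U p := by
  have hU := hS.isOpen
  have hΨ := hS.smooth
  have hg : ∀ q ∈ U, gramDet Ψ q ≠ 0 := fun q hq => (hS.lorentzian q hq).ne
  obtain ⟨a, b, c, d, ε, φ, β, θ, hε, hs, hpt, htU, hφ, hφs, hsum, hβ, hθ, hβn, hθn, hpos⟩ :=
    exists_null_chart hU hΨ hS.lorentzian hS.minimal hp
  have hε0 : ε ≠ 0 := by rintro rfl; norm_num at hε
  have hφU : ∀ q ∈ box a b c d, φ q ∈ U := fun q hq => htU (φ.map_source (hs ▸ hq))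
  have dφ : ∀ q ∈ box a b c d, DifferentiableAt ℝ φ q := fun q hq =>
    (hs ▸ hφ).differentiableAt_of_isOpen isOpen_box hq
  have hβ' : ContDiffOn ℝ ∞ (deriv β) (Ioo a b) := hβ.deriv_of_isOpen isOpen_Ioo (by simp)
  have hθ' : ContDiffOn ℝ ∞ (deriv θ) (Ioo c d) := hθ.deriv_of_isOpen isOpen_Ioo (by simp)
  have dβ' : ∀ t ∈ Ioo a b, DifferentiableAt ℝ (deriv β) t := fun t ht =>
    hβ'.differentiableAt_of_isOpen isOpen_Ioo ht
  have dθ' : ∀ s ∈ Ioo c d, DifferentiableAt ℝ (deriv θ) s := fun s hs =>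
    hθ'.differentiableAt_of_isOpen isOpen_Ioo hs
  have hβd : ∀ t ∈ Ioo a b, HasDerivAt β (deriv β t) t := fun t ht =>
    (hβ.differentiableAt_of_isOpen isOpen_Ioo ht).hasDerivAt
  have hθd : ∀ s ∈ Ioo c d, HasDerivAt θ (deriv θ s) s := fun s hs =>
    (hθ.differentiableAt_of_isOpen isOpen_Ioo hs).hasDerivAt
  have fΨ : ∀ q ∈ box a b c d, ∀ X : ℝ × ℝ, fderiv ℝ Ψ (φ q) (fderiv ℝ φ q X) =
      (X.1 + X.2) • deriv β (q.1 + q.2) + (X.1 - X.2) • deriv θ (q.1 - q.2) :=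
    fun q hq => fderiv_comp_of_eq_add hq (dφ q hq) (hΨ.differentiableAt_of_isOpen hU (hφU q hq))
      (hβd _ hq.1) (hθd _ hq.2) fun x hx => hsum x (hs ▸ hx)
  -- The heights of `β'` and `θ'` are `1` and `ε`, so `f₁ = 1/2` and `f₂ = ε/2` are constant.
  set g₁ : ℝ → ℝ := fun t => 1 * (deriv β t 1 + deriv β t 3) with hg₁
  set h₁ : ℝ → ℝ := fun t => 1 * (deriv β t 3 - deriv β t 1) with hh₁
  set g₂ : ℝ → ℝ := fun t => ε * (deriv θ t 1 + deriv θ t 3) with hg₂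
  set h₂ : ℝ → ℝ := fun t => ε * (deriv θ t 3 - deriv θ t 1) with hh₂
  have hβw : ∀ t ∈ Ioo a b, ((1 : ℝ) / 2) • wVec (g₁ t) (h₁ t) = deriv β t := fun t ht =>
    smul_wVec_eq (by norm_num) (hβn t ht).1 (hβn t ht).2
  have hθw : ∀ s ∈ Ioo c d, (ε / 2) • wVec (g₂ s) (h₂ s) = deriv θ s := fun s hs =>
    smul_wVec_eq hε (hθn s hs).1 (hθn s hs).2
  have hm : ∀ t ∈ Ioo a b, ∀ s ∈ Ioo c d, ip (deriv β t) (deriv θ s) =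
      ε / 2 * ((g₁ t - g₂ s) * (h₁ t - h₂ s)) := by
    intro t ht s hs
    rw [← hβw t ht, ← hθw s hs, ip_smul_wVec]; ring
  have hne : ∀ t ∈ Ioo a b, ∀ s ∈ Ioo c d, g₁ t - g₂ s ≠ 0 ∧ h₁ t - h₂ s ≠ 0 := by
    intro t ht s hs
    have h := (hpos t ht s hs).ne'
    rw [hm t ht s hs] at h
    have := right_ne_zero_of_mul h
    exact ⟨left_ne_zero_of_mul this, right_ne_zero_of_mul this⟩
  have hββ : ∀ t ∈ Ioo a b, ip (deriv (deriv β) t) (deriv (deriv β) t) =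
      -(deriv g₁ t * deriv h₁ t) := by
    intro t ht
    obtain ⟨e1, e2⟩ := deriv_coord (dβ' t ht) 1
    rw [hg₁, hh₁, e1, e2, ip_self_of_height_eq_zero (height_deriv isOpen_Ioo
      (hβ'.differentiableOn (by simp)) (fun t ht => (hβn t ht).2) ht)]
    ring
  have hθθ : ∀ s ∈ Ioo c d, ip (deriv (deriv θ) s) (deriv (deriv θ) s) =
      -(deriv g₂ s * deriv h₂ s) := by
    intro s hs
    obtain ⟨e1, e2⟩ := deriv_coord (dθ' s hs) ε
    rw [hg₂, hh₂, e1, e2, ip_self_of_height_eq_zero (height_deriv isOpen_Ioo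
      (hθ'.differentiableOn (by simp)) (fun s hs => (hθn s hs).2) hs)]
    linear_combination ((deriv (deriv θ) s 1 + deriv (deriv θ) s 3) *
      (deriv (deriv θ) s 3 - deriv (deriv θ) s 1)) * hε
  have hcurv : ∀ q ∈ box a b c d, ∀ (X Y : ℝ × ℝ) (e₁ e₂ : R42),
      IsAdaptedFrame Ψ (φ q) X Y e₁ e₂ →
      gaussCurvature Ψ (φ q) ^ 2 - normalCurvature Ψ (φ q) X Y e₁ e₂ ^ 2 =
        deriv g₁ (q.1 + q.2) * deriv g₂ (q.1 - q.2) *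
          deriv h₁ (q.1 + q.2) * deriv h₂ (q.1 - q.2) /
        ((1 / 2) ^ 2 * (ε / 2) ^ 2 *
          (g₁ (q.1 + q.2) - g₂ (q.1 - q.2)) ^ 4 * (h₁ (q.1 + q.2) - h₂ (q.1 - q.2)) ^ 4) := by
    intro q hq X Y e₁ e₂ hfr
    have hqU := hφU q hq
    have hqt : φ q ∈ φ.target := φ.map_source (hs ▸ hq)
    have hinv : ∀ x ∈ box a b c d, φ.symm (φ x) = x := fun x hx => φ.left_inv (hs ▸ hx)
    have hbt : ∀ x ∈ φ.target, φ.symm x ∈ box a b c d := fun x hx => hs ▸ φ.map_target hx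
    have hΨq := hΨ.contDiffAt (hU.mem_nhds hqU)
    have dsymm := hφs.differentiableAt_of_isOpen φ.open_target hqt
    -- the coordinate fields on the parameter domain of `Ψ`
    have dN : ∀ Z : ℝ × ℝ, DifferentiableAt ℝ (fun x => fderiv ℝ φ (φ.symm x) Z) (φ q) := by
      intro Z
      have h1 : ContDiffOn ℝ ∞ (fun x => fderiv ℝ φ x Z) (box a b c d) :=
        contDiffOn_fderiv_apply isOpen_box (hs ▸ hφ) contDiffOn_const
      have h2 : DifferentiableAt ℝ (fun x => fderiv ℝ φ x Z) (φ.symm (φ q)) := by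
        rw [hinv q hq]; exact h1.differentiableAt_of_isOpen isOpen_box hq
      exact h2.comp (φ q) dsymm
    set M := fderiv ℝ φ q (1 / 2, 1 / 2) with hM
    set N := fderiv ℝ φ q (1 / 2, -1 / 2) with hN
    have hΨM : fderiv ℝ Ψ (φ q) M = deriv β (q.1 + q.2) := by
      rw [hM, fΨ q hq]; norm_num
    have hΨN : fderiv ℝ Ψ (φ q) N = deriv θ (q.1 - q.2) := by
      rw [hN, fΨ q hq]; norm_num
    have hMM : ip (fderiv ℝ Ψ (φ q) M) (fderiv ℝ Ψ (φ q) M) = 0 := by rw [hΨM, (hβn _ hq.1).1]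
    have hNN : ip (fderiv ℝ Ψ (φ q) N) (fderiv ℝ Ψ (φ q) N) = 0 := by rw [hΨN, (hθn _ hq.2).1]
    have hMN : ip (fderiv ℝ Ψ (φ q) M) (fderiv ℝ Ψ (φ q) N) ≠ 0 := by
      rw [hΨM, hΨN]; exact (hpos _ hq.1 _ hq.2).ne'
    -- Extend `M` by the field that `φ` carries over from `(1/2, 1/2)`. Its image under `dΨ` is `β'`
    -- at the current parameter, and the derivative of this along `M` is `β''`.
    have hσM : sff Ψ (φ q) M M = nor Ψ (φ q) (deriv (deriv β) (q.1 + q.2)) := by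
      have h1 := nor_fderiv_tangent_field hΨq (hg _ hqU) (dN (1 / 2, 1 / 2)) M
      rw [hinv q hq] at h1
      have he : (fun x => fderiv ℝ Ψ x (fderiv ℝ φ (φ.symm x) (1 / 2, 1 / 2))) =ᶠ[nhds (φ q)]
          fun x => deriv β ((φ.symm x).1 + (φ.symm x).2) := by
        filter_upwards [φ.open_target.mem_nhds hqt] with x hx
        have h := fΨ _ (hbt x hx) (1 / 2, 1 / 2)
        rw [φ.right_inv hx] at h
        rw [h]; norm_num
      have hd : DifferentiableAt ℝ (fun x => deriv β ((φ.symm x).1 + (φ.symm x).2)) (φ q) := by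
        refine DifferentiableAt.comp (φ q) (g := deriv β) ?_ (dsymm.fst.add dsymm.snd)
        rw [hinv q hq]; exact dβ' _ hq.1
      have h2 := fderiv_comp_of_eq_add (θ := fun _ => (0 : R42)) hq (dφ q hq) hd
        (dβ' _ hq.1).hasDerivAt (hasDerivAt_const _ _)
        (fun x hx => by rw [hinv x hx, add_zero]) (1 / 2, 1 / 2)
      rw [← h1, he.fderiv_eq, hM, h2]
      norm_num
    have hσN : sff Ψ (φ q) N N = nor Ψ (φ q) (deriv (deriv θ) (q.1 - q.2)) := by
      have h1 := nor_fderiv_tangent_field hΨq (hg _ hqU) (dN (1 / 2, -1 / 2)) N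
      rw [hinv q hq] at h1
      have he : (fun x => fderiv ℝ Ψ x (fderiv ℝ φ (φ.symm x) (1 / 2, -1 / 2))) =ᶠ[nhds (φ q)]
          fun x => deriv θ ((φ.symm x).1 - (φ.symm x).2) := by
        filter_upwards [φ.open_target.mem_nhds hqt] with x hx
        have h := fΨ _ (hbt x hx) (1 / 2, -1 / 2)
        rw [φ.right_inv hx] at h
        rw [h]; norm_num
      have hd : DifferentiableAt ℝ (fun x => deriv θ ((φ.symm x).1 - (φ.symm x).2)) (φ q) := by
        refine DifferentiableAt.comp (φ q) (g := deriv θ) ?_ (dsymm.fst.sub dsymm.snd)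
        rw [hinv q hq]; exact dθ' _ hq.2
      have h2 := fderiv_comp_of_eq_add (β := fun _ => (0 : R42)) hq (dφ q hq) hd
        (hasDerivAt_const _ _) (dθ' _ hq.2).hasDerivAt
        (fun x hx => by rw [hinv x hx, zero_add]) (1 / 2, -1 / 2)
      rw [← h1, he.fderiv_eq, hN, h2]
      norm_num
    have hβo : ip (deriv (deriv β) (q.1 + q.2)) (fderiv ℝ Ψ (φ q) M) = 0 := by
      rw [hΨM]
      exact ip_deriv_of_null isOpen_Ioo (hβ'.differentiableOn (by simp))
        (fun t ht => (hβn t ht).1) hq.1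
    have hθo : ip (deriv (deriv θ) (q.1 - q.2)) (fderiv ℝ Ψ (φ q) N) = 0 := by
      rw [hΨN]
      exact ip_deriv_of_null isOpen_Ioo (hθ'.differentiableOn (by simp))
        (fun t ht => (hθn t ht).1) hq.2
    have hNM : ip (fderiv ℝ Ψ (φ q) N) (fderiv ℝ Ψ (φ q) M) ≠ 0 := by rwa [ip_comm]
    obtain ⟨hne1, hne2⟩ := hne _ hq.1 _ hq.2
    rw [gaussCurvature_sq_sub_normalCurvature_sq hU hΨ hg hqU (hS.minimal _ hqU) hfr hMM hNN hMN,
      hσM, hσN, ip_nor_nor_of_orthogonal_null (hg _ hqU) hMM hMN hβo,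
      ip_nor_nor_of_orthogonal_null (hg _ hqU) hNN hNM hθo, hββ _ hq.1, hθθ _ hq.2, hΨM, hΨN,
      hm _ hq.1 _ hq.2]
    -- `⟨β',θ'⟩⁴` contains `(ε/2)⁴`, whereas the formula asks for `f₁²f₂² = (1/2)²(ε/2)²`.
    have hε4 : ε ^ 4 = ε ^ 2 := by rw [hε, show ε ^ 4 = (ε ^ 2) ^ 2 by ring, hε]; norm_num
    congr 1
    · ring
    · rw [mul_pow, mul_pow, div_pow, div_pow, hε4]; ring
  refine ⟨a, b, c, d, φ, β, θ, fun _ => 1 / 2, g₁, h₁, fun _ => ε / 2, g₂, h₂, hs, hpt, htU, hφ, hφs,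
    ?_, hsum, ⟨hβ, fun t ht => ⟨?_, (hβn t ht).1⟩⟩, ⟨hθ, fun s hs => ⟨?_, (hθn s hs).1⟩⟩,
    contDiffOn_const, ?_, ?_, contDiffOn_const, ?_, ?_, fun t ht => ?_, fun s hs => ?_,
    fun t ht s hs' => ⟨?_, ?_⟩, fun q hq => hcurv q (hs ▸ hq)⟩
  · intro q hq
    rw [hs] at hq
    have hu : ∀ X, fderiv ℝ (Ψ ∘ φ) q X =
        (X.1 + X.2) • deriv β (q.1 + q.2) + (X.1 - X.2) • deriv θ (q.1 - q.2) := by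
      intro X
      rw [fderiv_comp q (hΨ.differentiableAt_of_isOpen hU (hφU q hq)) (dφ q hq)]
      exact fΨ q hq X
    have h1 := (hβn _ hq.1).1
    have h2 := (hθn _ hq.2).1
    have h3 := hpos _ hq.1 _ hq.2
    simp only [coeffE, coeffF, coeffG, du, dv, hu, ip_add_left, ip_add_right, ip_smul_left,
      ip_smul_right, h1, h2, ip_comm (deriv θ (q.1 - q.2)) (deriv β (q.1 + q.2))]
    refine ⟨?_, ?_, ?_⟩
    · linarith
    · ring
    · ring
  · intro h0
    have := (hβn t ht).2
    rw [h0, map_zero] at this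
    norm_num at this
  · intro h0
    have := (hθn s hs).2
    rw [h0, map_zero] at this
    exact hε0 this.symm
  · exact contDiffOn_const.mul ((contDiffOn_pi.1 hβ' 1).add (contDiffOn_pi.1 hβ' 3))
  · exact contDiffOn_const.mul ((contDiffOn_pi.1 hβ' 3).sub (contDiffOn_pi.1 hβ' 1))
  · exact contDiffOn_const.mul ((contDiffOn_pi.1 hθ' 1).add (contDiffOn_pi.1 hθ' 3))
  · exact contDiffOn_const.mul ((contDiffOn_pi.1 hθ' 3).sub (contDiffOn_pi.1 hθ' 1))
  · rw [hβw t ht]; exact hβd t ht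
  · rw [hθw s hs]; exact hθd s hs
  · obtain ⟨h1, h2⟩ := hne t ht s hs'
    exact mul_ne_zero (mul_ne_zero (mul_ne_zero (by norm_num) (by simpa using hε0)) h1) h2
  · obtain ⟨hne1, hne2⟩ := hne t ht s hs'
    have hq := mk_mem_box ht hs'
    -- The denominator of the curvature formula is positive, so `K² - ϰ² > 0` makes the numerator
    -- positive.
    obtain ⟨X, Y, e₁, e₂, hfr, hK⟩ := hS.curvature_pos _ (hφU _ hq)
    rw [hcurv _ hq X Y e₁ e₂ hfr] at hK
    have e1 : (t + s) / 2 + (t - s) / 2 = t := by ring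
    have e2 : (t + s) / 2 - (t - s) / 2 = s := by ring
    simp only [e1, e2] at hK
    exact (div_pos_iff_of_pos_right (by positivity)).1 hK

/-! ### Motions to general position, and density of the regular points -/

lemma ip_shearEquiv (l m : ℝ) (x y : R42) : ip (shearEquiv l m x) (shearEquiv l m y) = ip x y :=
  (isLinearMotion_shear l m).1 x y

lemma exists_null_basis {Ψ : ℝ × ℝ → R42} {q : ℝ × ℝ} (hq : gramDet Ψ q < 0) :
    ∃ M N : ℝ × ℝ, M ≠ 0 ∧ N ≠ 0 ∧ ∀ X : ℝ × ℝ, ip (fderiv ℝ Ψ q X) (fderiv ℝ Ψ q X) = 0 →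
      ∃ r : ℝ, X = r • M ∨ X = r • N := by
  have hW := area_pos hq
  have hW2 := area_sq hq
  by_cases hE : coeffE Ψ q = 0
  · have hF : coeffF Ψ q ≠ 0 := by
      intro hF
      rw [gramDet, hE, hF] at hq
      norm_num at hq
    -- For `E = 0` the form is `X₂(2F X₁ + G X₂)`; otherwise its roots are `X₁/X₂ = (±W - F)/E`.
    refine ⟨(1, 0), (coeffG Ψ q, -2 * coeffF Ψ q), by simp, by simp [hF], fun X hX => ?_⟩
    rw [ip_fderiv_fderiv, hE] at hX
    have hX' : X.2 * (2 * X.1 * coeffF Ψ q + X.2 * coeffG Ψ q) = 0 := by linarith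
    rcases mul_eq_zero.1 hX' with h | h
    · exact ⟨X.1, Or.inl (by ext <;> simp [h])⟩
    · refine ⟨-X.2 / (2 * coeffF Ψ q), Or.inr ?_⟩
      ext
      · simp only [Prod.smul_fst, smul_eq_mul]
        field_simp
        linarith
      · simp only [Prod.smul_snd, smul_eq_mul]
        field_simp
  · refine ⟨(area Ψ q - coeffF Ψ q, coeffE Ψ q), (-area Ψ q - coeffF Ψ q, coeffE Ψ q),
      fun h => hE (congrArg Prod.snd h), fun h => hE (congrArg Prod.snd h), fun X hX => ?_⟩
    rw [ip_fderiv_fderiv] at hX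
    have hX' : (coeffE Ψ q * X.1 + (coeffF Ψ q - area Ψ q) * X.2) *
        (coeffE Ψ q * X.1 + (coeffF Ψ q + area Ψ q) * X.2) = 0 := by
      linear_combination coeffE Ψ q * hX - X.2 ^ 2 * hW2
    refine ⟨X.2 / coeffE Ψ q, ?_⟩
    rcases mul_eq_zero.1 hX' with h | h
    · left
      ext
      · simp only [Prod.smul_fst, smul_eq_mul]
        field_simp
        linarith
      · simp only [Prod.smul_snd, smul_eq_mul]
        field_simp
    · right
      ext
      · simp only [Prod.smul_fst, smul_eq_mul]
        field_simp
        linarith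
      · simp only [Prod.smul_snd, smul_eq_mul]
        field_simp

lemma exists_shear_mem_regularPoints {Ψ : ℝ × ℝ → R42} {U : Set (ℝ × ℝ)} {p : ℝ × ℝ} (hp : p ∈ U)
    (hl : gramDet Ψ p < 0) :
    ∃ l m : ℝ, p ∈ regularPoints (fun q => shearEquiv l m (Ψ q)) U := by
  obtain ⟨M, N, hM, hN, hMN⟩ := exists_null_basis hl
  obtain ⟨l, m, h1, h2⟩ := exists_shear_ne_zero
    (x := fderiv ℝ Ψ p M) (y := fderiv ℝ Ψ p N)
    (fun h => hM (fderiv_injective hl.ne h)) (fun h => hN (fderiv_injective hl.ne h))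
  refine ⟨l, m, hp, fun X hX0 hX => ?_⟩
  rw [fderiv_isometry, ip_shearEquiv] at hX
  rw [fderiv_isometry, shearEquiv_apply]
  obtain ⟨r, rfl | rfl⟩ := hMN X hX
  · have hr : r ≠ 0 := by rintro rfl; simp at hX0
    simp only [map_smul, Pi.smul_apply, smul_eq_mul, ← mul_add]
    exact mul_ne_zero hr h1
  · have hr : r ≠ 0 := by rintro rfl; simp at hX0
    simp only [map_smul, Pi.smul_apply, smul_eq_mul, ← mul_add]
    exact mul_ne_zero hr h2

/-- For `l ≠ 0` the function `l g` has nonzero derivative at `t`, so it avoids the value `1` on a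
punctured neighbourhood. -/
lemma eventually_one_sub_mul_ne_zero {g : ℝ → ℝ} {t : ℝ} (hg : DifferentiableAt ℝ g t)
    (hg' : deriv g t ≠ 0) (l : ℝ) : ∀ᶠ x in nhdsWithin t {t}ᶜ, 1 - l * g x ≠ 0 := by
  by_cases hl : l = 0
  · simp [hl]
  · have hd : HasDerivAt (fun x => l * g x) (l * deriv g t) t := hg.hasDerivAt.const_mul l
    filter_upwards [hd.eventually_ne (c := 1) (mul_ne_zero hl hg')] with x hx
    exact sub_ne_zero.2 (Ne.symm hx)

/-- Represent a sheared surface near `p` and express the original height in its Weierstrass data.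
That height can vanish on a null direction only for exceptional `t` or `s`, which can be avoided
arbitrarily close to `p`. -/
lemma subset_closure_regularPoints {Ψ : ℝ × ℝ → R42} {U : Set (ℝ × ℝ)}
    (hS : IsMinimalLorentzianGeneralType Ψ U) : U ⊆ closure (regularPoints Ψ U) := by
  intro p hp
  obtain ⟨l, m, hreg⟩ := exists_shear_mem_regularPoints hp (hS.lorentzian p hp)
  have hSA := hS.isometry (shearEquiv l m) (ip_shearEquiv l m)
  obtain ⟨a, b, c, d, φ, β, θ, f₁, g₁, h₁, f₂, g₂, h₂, hs, hpt, htU, hφ, -, hiso, hsum, -, -, -,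
    hg₁, hh₁, -, hg₂, hh₂, hβ, hθ, hne, -⟩ := hasWeierstrassRep_of_mem_regularPoints hSA hreg
  change φ.source = box a b c d at hs
  have hφU : ∀ q ∈ box a b c d, φ q ∈ U := fun q hq => htU (φ.map_source (hs ▸ hq))
  have dφ : ∀ q ∈ box a b c d, DifferentiableAt ℝ φ q := fun q hq =>
    (hs ▸ hφ).differentiableAt_of_isOpen isOpen_box hq
  have hmem : φ.symm p ∈ box a b c d := hs ▸ φ.map_target hpt
  set t₀ := (φ.symm p).1 + (φ.symm p).2 with ht₀
  set s₀ := (φ.symm p).1 - (φ.symm p).2 with hs₀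
  have hpos := (hne t₀ hmem.1 s₀ hmem.2).2.ne'
  have hg₁' : deriv g₁ t₀ ≠ 0 := fun h => hpos (by rw [h]; ring)
  have hg₂' : deriv g₂ s₀ ≠ 0 := fun h => hpos (by rw [h]; ring)
  have hh₁' : deriv h₁ t₀ ≠ 0 := fun h => hpos (by rw [h]; ring)
  have hh₂' : deriv h₂ s₀ ≠ 0 := fun h => hpos (by rw [h]; ring)
  -- at the parameters `(t, s)` with these properties the point is regular
  have key : ∀ t ∈ Ioo a b, ∀ s ∈ Ioo c d, 1 - l * g₁ t ≠ 0 → 1 - m * h₁ t ≠ 0 →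
      1 - l * g₂ s ≠ 0 → 1 - m * h₂ s ≠ 0 →
      φ ((t + s) / 2, (t - s) / 2) ∈ regularPoints Ψ U := by
    intro t ht s hs' k1 k2 k3 k4
    have hq := mk_mem_box ht hs'
    have hqU := hφU _ hq
    have ne := (hne t ht s hs').1
    have hf₁ : f₁ t ≠ 0 := fun h => ne (by rw [h]; ring)
    have hf₂ : f₂ s ≠ 0 := fun h => ne (by rw [h]; ring)
    set q : ℝ × ℝ := ((t + s) / 2, (t - s) / 2) with hqdef
    have e1 : q.1 + q.2 = t := by simp only [hqdef]; ring
    have e2 : q.1 - q.2 = s := by simp only [hqdef]; ring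
    have hdΨ := hSA.smooth.differentiableAt_of_isOpen hS.isOpen hqU
    have fΨ : ∀ X : ℝ × ℝ, shear l m (fderiv ℝ Ψ (φ q) (fderiv ℝ φ q X)) =
        (X.1 + X.2) • (f₁ t • wVec (g₁ t) (h₁ t)) + (X.1 - X.2) • (f₂ s • wVec (g₂ s) (h₂ s)) := by
      intro X
      have := fderiv_comp_of_eq_add hq (dφ q hq) hdΨ
        (by rw [e1]; exact hβ t ht) (by rw [e2]; exact hθ s hs') (fun x hx => hsum x (hs ▸ hx)) X
      rwa [fderiv_isometry] at this
    -- The matrix of `wVec g h` is `2 (1, g)ᵀ(1, h)`, of rank one, so undoing the shear gives a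
    -- height that factors.
    have hheight : ∀ (w : R42) (f g h : ℝ), shear l m w = f • wVec g h →
        w 0 + w 2 = 2 * (f * ((1 - l * g) * (1 - m * h))) := by
      intro w f g h hw
      rw [zero_add_two_eq_shear l m w, hw]
      simp [wVec]
      ring
    have hsurj : ∀ Y : ℝ × ℝ, ∃ X, fderiv ℝ φ q X = Y := by
      have hinj : Function.Injective (fderiv ℝ φ q) := by
        rw [injective_iff_map_eq_zero]
        intro X hX
        have h := hiso q (hs ▸ hq)
        apply fderiv_injective (Ψ := (fun x => shearEquiv l m (Ψ x)) ∘ φ) (q := q)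
        · rw [gramDet, h.2.2, ← neg_eq_iff_eq_neg.2 h.2.1]
          have := h.1
          nlinarith
        · rw [fderiv_comp q hdΨ (dφ q hq), ContinuousLinearMap.comp_apply, hX, map_zero]
      exact LinearMap.injective_iff_surjective (f := (fderiv ℝ φ q : ℝ × ℝ →ₗ[ℝ] ℝ × ℝ)).1 hinj
    refine ⟨hqU, fun Y hY0 hY => ?_⟩
    obtain ⟨X, rfl⟩ := hsurj Y
    have hX0 : X ≠ 0 := fun h => hY0 (by rw [h, map_zero])
    -- In these isothermal parameters the null directions are `u + v = const` and `u - v = const`,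
    -- so the tangent vector is a multiple of `θ'` or of `β'`.
    have hnull : (X.1 + X.2) * (X.1 - X.2) = 0 := by
      rw [← ip_shearEquiv l m, shearEquiv_apply, fΨ] at hY
      simp only [ip_add_left, ip_add_right, ip_smul_left, ip_smul_right] at hY
      have w0 : ∀ g h, ip (wVec g h) (wVec g h) = 0 := by
        intro g h
        simpa using ip_smul_wVec 1 g h 1 g h
      have w1 : ip (wVec (g₁ t) (h₁ t)) (wVec (g₂ s) (h₂ s)) =
          2 * ((g₁ t - g₂ s) * (h₁ t - h₂ s)) := by
        simpa using ip_smul_wVec 1 (g₁ t) (h₁ t) 1 (g₂ s) (h₂ s)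
      rw [w0, w0, ip_comm (wVec (g₂ s) (h₂ s)), w1] at hY
      have : (X.1 + X.2) * (X.1 - X.2) *
          (f₁ t * f₂ s * (g₁ t - g₂ s) * (h₁ t - h₂ s)) = 0 := by linarith
      exact (mul_eq_zero.1 this).resolve_right ne
    rcases mul_eq_zero.1 hnull with h | h
    · have hX := fΨ X
      rw [h, zero_smul, zero_add, smul_smul] at hX
      rw [hheight _ _ _ _ hX]
      have : X.1 - X.2 ≠ 0 := by
        intro h'
        apply hX0
        ext
        · change X.1 = 0; linarith
        · change X.2 = 0; linarith
      exact mul_ne_zero two_ne_zero (mul_ne_zero (mul_ne_zero this hf₂) (mul_ne_zero k3 k4))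
    · have hX := fΨ X
      rw [h, zero_smul, add_zero, smul_smul] at hX
      rw [hheight _ _ _ _ hX]
      have : X.1 + X.2 ≠ 0 := by
        intro h'
        apply hX0
        ext
        · change X.1 = 0; linarith
        · change X.2 = 0; linarith
      exact mul_ne_zero two_ne_zero (mul_ne_zero (mul_ne_zero this hf₁) (mul_ne_zero k1 k2))
  have dg₁ := hg₁.differentiableAt_of_isOpen isOpen_Ioo hmem.1
  have dh₁ := hh₁.differentiableAt_of_isOpen isOpen_Ioo hmem.1
  have dg₂ := hg₂.differentiableAt_of_isOpen isOpen_Ioo hmem.2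
  have dh₂ := hh₂.differentiableAt_of_isOpen isOpen_Ioo hmem.2
  have ev1 : ∀ᶠ t in nhdsWithin t₀ {t₀}ᶜ, t ∈ Ioo a b ∧ 1 - l * g₁ t ≠ 0 ∧ 1 - m * h₁ t ≠ 0 := by
    filter_upwards [mem_nhdsWithin_of_mem_nhds (isOpen_Ioo.mem_nhds hmem.1),
      eventually_one_sub_mul_ne_zero dg₁ hg₁' l, eventually_one_sub_mul_ne_zero dh₁ hh₁' m]
      with t h1 h2 h3 using ⟨h1, h2, h3⟩
  have ev2 : ∀ᶠ s in nhdsWithin s₀ {s₀}ᶜ, s ∈ Ioo c d ∧ 1 - l * g₂ s ≠ 0 ∧ 1 - m * h₂ s ≠ 0 := by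
    filter_upwards [mem_nhdsWithin_of_mem_nhds (isOpen_Ioo.mem_nhds hmem.2),
      eventually_one_sub_mul_ne_zero dg₂ hg₂' l, eventually_one_sub_mul_ne_zero dh₂ hh₂' m]
      with s h1 h2 h3 using ⟨h1, h2, h3⟩
  -- Approach `p` with `t ≠ t₀` and `s ≠ s₀` independently, since each of the four exceptional
  -- factors involves only one of the two variables.
  have hlim : Filter.Tendsto (fun x : ℝ × ℝ => φ ((x.1 + x.2) / 2, (x.1 - x.2) / 2))
      (nhdsWithin t₀ {t₀}ᶜ ×ˢ nhdsWithin s₀ {s₀}ᶜ) (nhds p) := by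
    have e : ((t₀ + s₀) / 2, (t₀ - s₀) / 2) = φ.symm p := by
      ext
      · simp only [ht₀, hs₀]; ring
      · simp only [ht₀, hs₀]; ring
    have hc : ContinuousAt (fun x : ℝ × ℝ => φ ((x.1 + x.2) / 2, (x.1 - x.2) / 2)) (t₀, s₀) := by
      refine ContinuousAt.comp (g := φ) ?_ (by fun_prop)
      simp only [e]
      exact (dφ _ hmem).continuousAt
    have h := hc.tendsto
    simp only [e, φ.right_inv hpt, nhds_prod_eq] at h
    exact h.mono_left (Filter.prod_mono nhdsWithin_le_nhds nhdsWithin_le_nhds)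
  refine mem_closure_of_tendsto hlim ?_
  filter_upwards [ev1.prod_mk ev2] with x hx
  exact key x.1 hx.1.1 x.2 hx.2.1 hx.1.2.1 hx.1.2.2 hx.2.2.1 hx.2.2.2

end NeutralSurface

end

theorem theorem4p1 (Ψ : ℝ × ℝ → NeutralSurface.R42) (U : Set (ℝ × ℝ))
    (hS : NeutralSurface.IsMinimalLorentzianGeneralType Ψ U) :
    (∀ p ∈ NeutralSurface.regularPoints Ψ U, NeutralSurface.HasWeierstrassRep Ψ U p) ∧
    (IsOpen (NeutralSurface.regularPoints Ψ U) ∧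
      U ⊆ closure (NeutralSurface.regularPoints Ψ U)) ∧
    (∀ p ∈ U, ∃ A : NeutralSurface.R42 →ₗ[ℝ] NeutralSurface.R42,
      NeutralSurface.IsLinearMotion A ∧
      NeutralSurface.HasWeierstrassRep (fun q => A (Ψ q)) U p) := by
  refine ⟨fun p hp => NeutralSurface.hasWeierstrassRep_of_mem_regularPoints hS hp,
    ⟨NeutralSurface.isOpen_regularPoints hS.isOpen hS.smooth hS.lorentzian,
      NeutralSurface.subset_closure_regularPoints hS⟩, fun p hp => ?_⟩
  obtain ⟨l, m, hreg⟩ := NeutralSurface.exists_shear_mem_regularPoints hp (hS.lorentzian p hp)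
  exact ⟨NeutralSurface.shear l m, NeutralSurface.isLinearMotion_shear l m,
    NeutralSurface.hasWeierstrassRep_of_mem_regularPoints
      (hS.isometry _ (NeutralSurface.ip_shearEquiv l m)) hreg⟩
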